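/- Let $\Sigma$ be a finite alphabet, $k\ge 1$, and let $\mathcal P(\Sigma^k)$ be the set of probability measures on $\Sigma^k$, viewed as vectors with the $\ell_\infty$-norm. For a word $\omega$ with $|\omega|\ge k$ let $\mathrm{fr}^k_\omega\in\mathcal P(\Sigma^k)$ be the empirical distribution of its $|\omega|-k+1$ length-$k$ subwords (counted with multiplicity). For $\Gamma\subseteq\mathcal P(\Sigma^k)$ let $\mathcal B(\Gamma)=\{\omega\in\Sigma^*: |\omega|\ge k,\ \mathrm{fr}^k_\omega\in\Gamma\}$ and $\mathcal B_m(\Gamma)=\mathcal B(\Gamma)\cap\Sigma^m$. The capacity of $S\subseteq\Sigma^*$ is $\mathrm{cap}(S)=\limsup_{n\to\infty}\frac1n\log_2|S\cap\Sigma^n|$ (with $\log_2 0=-\infty$). Let $\mathcal P_{\mathrm{si}}\subseteq\mathcal P(\Sigma^k)$ be the set of shift-invariant measures, i.e. those $\eta$ with $\sum_{a}\eta(a\phi)=\sum_a\eta(\phi a)$ for all $\phi\in\Sigma^{k-1}$. The set $\Gamma$ is called fat if $\mathrm{cl}(\mathrm{int}(\Gamma\cap\mathcal P_{\mathrm{si}}))=\mathrm{cl}(\Gamma\cap\mathcal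 P_{\mathrm{si}})$, with closure and interior taken relative to $\mathcal P_{\mathrm{si}}$. For $\epsilon>0$ let $$\Gamma_\epsilon=\{\eta\in\mathcal P(\Sigma^k): \inf_{\mu\in\mathcal P(\Sigma^k)\setminus\Gamma}\|\eta-\mu\|_\infty>\epsilon\}$$ (where $\inf\emptyset=\infty$), and call $\epsilon$ $\Gamma$-admissible if $\Gamma_\epsilon$ is fat and $\Gamma_\epsilon\cap\mathcal P_{\mathrm{si}}\ne\emptyset$. Let $R_m(\Gamma)=\mathcal B_m(\Gamma)^*$. A block graph is a graph with a single vertex and finitely many self-loops, labeled by words of a common length $q\ge 1$; its language $\mathcal L(G)$ is the set of labels of its nonempty finite paths. A $p:q$ block encoder for a set of words $L$ is a block graph $G$ with exactly $2^p$ edges, labels in $\Sigma^q$, finite anticipation (for some $a\ge 0$, paths of length $a+1$ with the same label have the same first edge), $\mathcal L(G)\subseteq L$, and $\mathrm{cap}(\mathcal L(G))=p/q$; the number $p/q$ is its rate. **Corollary.** Let $\Gamma\subseteq\mathcal P(\Sigma^k)$ be closed, convex and fat, with $\Gamma\cap\mathcal P_{\mathrm{si}}\neq\emptyset$. 1. For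 every $\delta>0$ there are integers $p\ge 0$, $q\ge 1$ and a $p:q$ block encoder for $\mathcal B(\Gamma)$ with $\mathrm{cap}(\mathcal B(\Gamma))-\delta<p/q\le\mathrm{cap}(\mathcal B(\Gamma))$. 2. Suppose moreover that some $\epsilon>0$ is $\Gamma$-admissible. Then for every $\delta>0$ there is $\epsilon_0>0$ such that every $\epsilon\in(0,\epsilon_0]$ is $\Gamma$-admissible and there is $M\in\mathbb N$ such that for all $m>M$ the block graph whose edges are labeled by the words of $\mathcal B_m(\Gamma_\epsilon)$, one edge per word, has language $R_m(\Gamma_\epsilon)\setminus\{\text{empty word}\}$, this language is contained in $\mathcal B(\Gamma)$, and $$\mathrm{cap}(\mathcal B(\Gamma))-\delta<\mathrm{cap}(R_m(\Gamma_\epsilon))\le\mathrm{cap}(\mathcal B(\Gamma)).$$ -/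

import Mathlib

open Filter Topology

universe u

namespace SCS

/-! ### Words, empirical frequencies and capacity

Words over the alphabet `α` are lists, `k`-tuples are functions `Fin k → α`, and a measure on
`k`-tuples is a vector `(Fin k → α) → ℝ`; this space carries the sup norm. -/

/-- The probability measures on `k`-tuples. -/
abbrev Prob (α : Type u) [Fintype α] (k : ℕ) : Set ((Fin k → α) → ℝ) :=
  stdSimplex ℝ (Fin k → α)

/-- The empirical distribution of the `k`-tuples in the word `w` (used only when `k ≤ |w|`): the
number of positions at which `φ` occurs, divided by `|w| - k + 1`. -/
noncomputable def fr {α : Type u} (k : ℕ) (w : List α) : (Fin k → α) → ℝ := fun φ =>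
  ({i : ℕ | i + k ≤ w.length ∧ (w.drop i).take k = List.ofFn φ}.ncard : ℝ) /
    ((w.length : ℝ) - (k : ℝ) + 1)

/-- The admissible words of a semiconstrained system `Γ`. The empirical distribution exists for
words of length at least `k` only. -/
def admissible {α : Type u} {k : ℕ} (Γ : Set ((Fin k → α) → ℝ)) : Set (List α) :=
  {w | k ≤ w.length ∧ fr k w ∈ Γ}

/-- The admissible words of length exactly `n`. -/
def admissibleOfLength {α : Type u} {k : ℕ} (n : ℕ) (Γ : Set ((Fin k → α) → ℝ)) :
    Set (List α) :=
  {w | w ∈ admissible Γ ∧ w.length = n}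

/-- Base-two logarithm of a natural number, with `log₂ 0 = -∞`. -/
noncomputable def log2 (c : ℕ) : EReal :=
  if c = 0 then ⊥ else ((Real.logb 2 (c : ℝ) : ℝ) : EReal)

/-- The capacity `limsup (1/n) log₂ |S ∩ Σⁿ|` of a set of words. -/
noncomputable def capacity {α : Type u} (S : Set (List α)) : EReal :=
  limsup (fun n : ℕ => ((1 / (n : ℝ) : ℝ) : EReal) * log2 {w ∈ S | w.length = n}.ncard) atTop

/-! ### Shift-invariant measures and fat systems -/

/-- The shift-invariant probability measures on tuples of length `r + 1`. -/
def ProbSI (α : Type u) [Fintype α] (r : ℕ) : Set ((Fin (r + 1) → α) → ℝ) :=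
  {η | η ∈ Prob α (r + 1) ∧ ∀ φ : Fin r → α,
    ∑ a : α, η (Fin.cons (α := fun _ => α) a φ) = ∑ a : α, η (Fin.snoc (α := fun _ => α) φ a)}

/-- `Γ` is fat: the closure of the interior of `Γ ∩ P_si` is the closure of `Γ ∩ P_si`, where
interior and closure are taken in the subspace `P_si`. -/
def IsFat {α : Type u} [Fintype α] {r : ℕ} (Γ : Set ((Fin (r + 1) → α) → ℝ)) : Prop :=
  closure (interior ((↑) ⁻¹' Γ : Set (ProbSI α r))) = closure ((↑) ⁻¹' Γ : Set (ProbSI α r))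

/-- The shrunken system `Γ_ε`: the probability measures whose sup-norm distance to the complement
of `Γ` (within the probability measures) exceeds `ε`. The distance to the empty set is `∞`. -/
def shrink {α : Type u} [Fintype α] {k : ℕ} (Γ : Set ((Fin k → α) → ℝ)) (ε : ℝ) :
    Set ((Fin k → α) → ℝ) :=
  {η | η ∈ Prob α k ∧ ENNReal.ofReal ε < Metric.infEDist η (Prob α k \ Γ)}

/-- `ε` is `Γ`-admissible: `Γ_ε` is fat and still contains a shift-invariant measure. -/
def IsAdmissibleEps {α : Type u} [Fintype α] {r : ℕ} (Γ : Set ((Fin (r + 1) → α) → ℝ))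
    (ε : ℝ) : Prop :=
  0 < ε ∧ (shrink Γ ε ∩ ProbSI α r).Nonempty ∧ IsFat (shrink Γ ε)

/-! ### Labeled graphs and encoders -/

/-- A finite directed graph, parallel edges allowed, with edges labeled by words of length `q`. -/
structure LabeledGraph (α : Type u) (q : ℕ) where
  V : Type u
  E : Type u
  finite_V : Finite V
  finite_E : Finite E
  src : E → V
  tgt : E → V
  label : E → List α
  length_label : ∀ e, (label e).length = q

namespace LabeledGraph

variable {α : Type u} {q : ℕ}

/-- A nonempty directed path, as the list of its edges. -/
def IsPath (G : LabeledGraph α q) (γ : List G.E) : Prop :=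
  γ ≠ [] ∧ γ.IsChain (fun e f => G.tgt e = G.src f)

/-- The label of a path: the concatenation of the labels of its edges. -/
def pathLabel (G : LabeledGraph α q) (γ : List G.E) : List α :=
  γ.flatMap G.label

/-- The language presented by the graph: the labels of its nonempty finite directed paths. -/
def language (G : LabeledGraph α q) : Set (List α) :=
  {w | ∃ γ, G.IsPath γ ∧ G.pathLabel γ = w}

/-- Anticipation `a`: paths of length `a + 1` from the same vertex with the same label have the
same first edge. -/
def HasAnticipation (G : LabeledGraph α q) (a : ℕ) : Prop :=
  ∀ (e e' : G.E) (γ γ' : List G.E), γ.length = a → γ'.length = a →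
    G.IsPath (e :: γ) → G.IsPath (e' :: γ') → G.src e = G.src e' →
    G.pathLabel (e :: γ) = G.pathLabel (e' :: γ') → e = e'

/-- `G` is a `p : q` encoder for the set of words `L` (its edge labels have length `q`): every
vertex has out-degree `2 ^ p`, the anticipation is finite, the language of `G` lies in `L`, and
its capacity is the rate `p / q`. -/
def IsEncoderFor (G : LabeledGraph α q) (p : ℕ) (L : Set (List α)) : Prop :=
  (∀ v : G.V, {e : G.E | G.src e = v}.ncard = 2 ^ p) ∧
  (∃ a : ℕ, G.HasAnticipation a) ∧
  G.language ⊆ L ∧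
  capacity G.language = (((p : ℝ) / (q : ℝ) : ℝ) : EReal)

/-- A block encoder has a single state. -/
def IsBlock (G : LabeledGraph α q) : Prop := Nat.card G.V = 1

end LabeledGraph

/-! ### The block construction -/

/-- The language `R_m(Γ)`: all concatenations (the empty one included) of admissible words of
length `m`. -/
def blockLanguage {α : Type u} {k : ℕ} (m : ℕ) (Γ : Set ((Fin k → α) → ℝ)) : Set (List α) :=
  {w | ∃ ws : List (List α), (∀ v ∈ ws, v ∈ admissibleOfLength m Γ) ∧ ws.flatten = w}

theorem finite_admissibleOfLength {α : Type u} [Finite α] {k : ℕ} (m : ℕ)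
    (Γ : Set ((Fin k → α) → ℝ)) : (admissibleOfLength m Γ).Finite :=
  (List.finite_length_eq α m).subset fun _ hw => hw.2

/-- The single-state graph with one self loop for each admissible word of length `m`, labeled by
that word. -/
def blockGraph {α : Type u} [Finite α] {k : ℕ} (m : ℕ) (Γ : Set ((Fin k → α) → ℝ)) :
    LabeledGraph α m where
  V := PUnit
  E := admissibleOfLength m Γ
  finite_V := inferInstance
  finite_E := (finite_admissibleOfLength m Γ).to_subtype
  src := fun _ => PUnit.unit
  tgt := fun _ => PUnit.unit
  label := fun e => e.1
  length_label := fun e => e.2.2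

end SCS

namespace SCS

/-! Write `r + 1` for the window length. Concatenating two words creates at most `r` new windows,
and a word that begins and ends with the same `r`-word `u` has an exactly shift-invariant empirical
distribution (`fr_mem_ProbSI`). Conversely every shift-invariant measure is approximated by words of
all large lengths (`ProbSI_subset_realizable`): the approximable vectors form a closed convex set,
and a functional separating a shift-invariant measure from it is ruled out by a potential on the de
Bruijn graph.

Fatness provides a strictly positive shift-invariant `η₀` with a ball, relative to the
shift-invariant measures, inside `Γ`. Each admissible word `w` of a suitable large length becomes a
block `u w x u`, with one fixed, much shorter filler `x` of statistics near `η₀`. Concatenated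
blocks have distribution near `a s + (1 - a) η₀` with `s` in `Γ` and `1 - a` bounded below. Solving
for the second endpoint puts the error into the ball around `η₀`, so convexity gives membership in
`Γ` (`mem_of_near_combination`). The filler costs little rate. Keeping `2 ^ p` blocks gives the
encoder.

For the shrunken systems, admissibility provides a ball in the whole simplex, so the same code,
padded to any large length `m`, yields enough words of `Γ_ε`. The inclusion in the admissible words
of `Γ` holds because junction windows move the distribution by at most `r / m ≤ ε`
(`fr_flatten_mem`). -/

open scoped Classical in
/-- The number of occurrences of the tuple `φ` in a word. -/
noncomputable def occ {α : Type u} {r : ℕ} (φ : Fin (r + 1) → α) : List α → ℕ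
  | [] => 0
  | a :: w => (if (a :: w).take (r + 1) = List.ofFn φ then 1 else 0) + occ φ w

/-! ### Window counts, concatenation and shift invariance -/

section Occurrences

variable {α : Type u} {r : ℕ}

@[simp] theorem occ_nil (φ : Fin (r + 1) → α) : occ φ [] = 0 := rfl

open scoped Classical in
theorem occ_cons (φ : Fin (r + 1) → α) (a : α) (w : List α) :
    occ φ (a :: w) = (if (a :: w).take (r + 1) = List.ofFn φ then 1 else 0) + occ φ w := rfl

theorem ncard_windows (φ : Fin (r + 1) → α) (w : List α) :
    {i : ℕ | i + (r + 1) ≤ w.length ∧ (w.drop i).take (r + 1) = List.ofFn φ}.ncard = occ φ w := by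
  classical
  have hfin : ∀ w : List α,
      {i : ℕ | i + (r + 1) ≤ w.length ∧ (w.drop i).take (r + 1) = List.ofFn φ}.Finite := fun w =>
    (Set.finite_le_nat w.length).subset fun i hi => by
      have := hi.1
      simp only [Set.mem_ofPred_eq]; omega
  induction w with
  | nil => simp
  | cons a w ih =>
    have hlen : (a :: w).take (r + 1) = List.ofFn φ → r + 1 ≤ w.length + 1 := fun h => by
      have := congrArg List.length h
      simp at this; omega
    have hset : {i : ℕ | i + (r + 1) ≤ (a :: w).length ∧
          ((a :: w).drop i).take (r + 1) = List.ofFn φ} =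
        (if (a :: w).take (r + 1) = List.ofFn φ then {0} else ∅) ∪
          Nat.succ '' {i : ℕ | i + (r + 1) ≤ w.length ∧
            (w.drop i).take (r + 1) = List.ofFn φ} := by
      ext i
      rcases i with _ | i
      · split_ifs with h
        · have := hlen h
          exact iff_of_true ⟨by simp; omega, h⟩ (Or.inl rfl)
        · refine iff_of_false (fun h' => h h'.2) ?_
          rintro (h' | ⟨x, _, hx⟩)
          · exact h'
          · simp at hx
      · split_ifs with h <;> simp <;> intro _ <;> omega
    rw [hset, Set.ncard_union_eq _ (by split_ifs <;> simp) ((hfin w).image _),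
      Set.ncard_image_of_injective _ Nat.succ_injective, ih, occ_cons]
    · split_ifs <;> simp
    · split_ifs <;> simp

theorem fr_apply (w : List α) (φ : Fin (r + 1) → α) :
    fr (r + 1) w φ = (occ φ w : ℝ) / ((w.length : ℝ) - r) := by
  simp only [fr, ncard_windows]
  push_cast
  congr 1; ring

theorem occ_eq_zero (φ : Fin (r + 1) → α) {w : List α} (h : w.length ≤ r) : occ φ w = 0 := by
  induction w with
  | nil => rfl
  | cons a w ih =>
    simp only [List.length_cons] at h
    rw [occ_cons, ih (by omega), if_neg]
    intro h'
    have := congrArg List.length h'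
    simp at this; omega

/-- With an overlap of exactly `r` letters, each window of length `r + 1` lies in exactly one of the
two pieces, so the count is additive without error. -/
theorem occ_append_overlap (φ : Fin (r + 1) → α) (w : List α) {u : List α} (hu : u.length = r)
    (v : List α) : occ φ (w ++ (u ++ v)) = occ φ (w ++ u) + occ φ (u ++ v) := by
  induction w with
  | nil => simp [occ_eq_zero φ hu.le]
  | cons a w ih =>
    have : (a :: (w ++ (u ++ v))).take (r + 1) = (a :: (w ++ u)).take (r + 1) := by
      simp only [List.take_succ_cons, ← List.append_assoc w u v]
      rw [List.take_append_of_le_length (by simp; omega)]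
    rw [List.cons_append, List.cons_append, occ_cons, occ_cons, this, ih]
    omega

theorem occ_add_le_occ_append (φ : Fin (r + 1) → α) (w v : List α) :
    occ φ w + occ φ v ≤ occ φ (w ++ v) := by
  classical
  induction w with
  | nil => simp
  | cons a w ih =>
    simp only [List.cons_append, occ_cons]
    have : (a :: w).take (r + 1) = List.ofFn φ → (a :: (w ++ v)).take (r + 1) = List.ofFn φ := by
      intro h
      have := congrArg List.length h
      simp only [List.length_take, List.length_cons, List.length_ofFn] at this
      rw [← h, ← List.cons_append, List.take_append_of_le_length (by simp; omega)]
    split_ifs with h1 h2 <;> first | omega | exact absurd (this h1) h2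

/-- Only windows starting in the last `r` letters of `w` can cross the junction; the minimum is the
form that survives induction on `w`. -/
theorem occ_append_le_aux (φ : Fin (r + 1) → α) (w v : List α) :
    occ φ (w ++ v) ≤ occ φ w + occ φ v + min w.length r := by
  classical
  induction w with
  | nil => simp
  | cons a w ih =>
    simp only [List.cons_append, occ_cons, List.length_cons]
    by_cases hr : r ≤ w.length
    · have : (a :: (w ++ v)).take (r + 1) = (a :: w).take (r + 1) := by
        rw [← List.cons_append, List.take_append_of_le_length (by simp; omega)]
      rw [this]
      omega
    · split_ifs <;> omega

theorem occ_append_le (φ : Fin (r + 1) → α) (w v : List α) :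
    occ φ (w ++ v) ≤ occ φ w + occ φ v + r :=
  (occ_append_le_aux φ w v).trans (by omega)

theorem abs_occ_append_sub_le (φ : Fin (r + 1) → α) (w v : List α) :
    |(occ φ (w ++ v) : ℝ) - (occ φ w + occ φ v)| ≤ r := by
  have h1 : ((occ φ w + occ φ v : ℕ) : ℝ) ≤ occ φ (w ++ v) := by
    exact_mod_cast occ_add_le_occ_append φ w v
  have h2 : (occ φ (w ++ v) : ℝ) ≤ ((occ φ w + occ φ v + r : ℕ) : ℝ) := by
    exact_mod_cast occ_append_le φ w v
  push_cast at h1 h2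
  rw [abs_le]; constructor <;> linarith

open scoped Classical in
theorem occ_ofFn (φ Φ : Fin (r + 1) → α) :
    occ φ (List.ofFn Φ) = if φ = Φ then 1 else 0 := by
  rw [List.ofFn_succ, occ_cons, occ_eq_zero φ (by simp), ← List.ofFn_succ,
    List.take_of_length_le (by simp)]
  simp only [List.ofFn_inj, eq_comm, add_zero]

theorem exists_ofFn_eq_take {k : ℕ} {w : List α} (h : k ≤ w.length) :
    ∃ ψ : Fin k → α, w.take k = List.ofFn ψ :=
  ⟨fun i => w[i], by
    apply List.ext_getElem
    · simp [h]
    · intro i h1 h2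
      simp⟩

variable [Fintype α]

theorem sum_occ {w : List α} (h : r ≤ w.length) :
    ∑ φ : Fin (r + 1) → α, occ φ w + r = w.length := by
  classical
  induction w with
  | nil => simp at h ⊢; omega
  | cons a w ih =>
    rcases h.lt_or_eq with h' | h'
    · simp only [List.length_cons] at h' ⊢
      obtain ⟨ψ, hψ⟩ := exists_ofFn_eq_take (k := r + 1) (w := a :: w) (by simp; omega)
      simp only [occ_cons, hψ, Finset.sum_add_distrib, List.ofFn_inj, Finset.sum_ite_eq,
        Finset.mem_univ, if_true]
      have := ih (by omega)
      omega
    · rw [Finset.sum_eq_zero fun φ _ => occ_eq_zero φ h'.ge]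
      omega

theorem occ_le_length (φ : Fin (r + 1) → α) (w : List α) : occ φ w ≤ w.length := by
  rcases le_total w.length r with h | h
  · simp [occ_eq_zero φ h]
  · rw [← sum_occ h]
    exact (Finset.single_le_sum (f := fun φ => occ φ w) (fun _ _ => Nat.zero_le _)
      (Finset.mem_univ φ)).trans (by omega)

theorem fr_mem_Prob {w : List α} (h : r < w.length) : fr (r + 1) w ∈ Prob α (r + 1) := by
  have hpos : (0 : ℝ) < (w.length : ℝ) - r := by
    have : (r : ℝ) < w.length := by exact_mod_cast h
    linarith
  refine ⟨fun φ => ?_, ?_⟩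
  · rw [fr_apply]; positivity
  · simp only [fr_apply]
    rw [← Finset.sum_div, div_eq_one_iff_eq hpos.ne']
    have := sum_occ (r := r) (w := w) h.le
    have h2 : ((∑ φ : Fin (r + 1) → α, occ φ w + r : ℕ) : ℝ) = w.length := by rw [this]
    push_cast at h2
    linarith

-- Both sides count the occurrences of the `r`-tuple `φ`: each is followed by a letter or terminal,
-- and each is preceded by a letter or initial.
open scoped Classical in
theorem sum_occ_snoc_add (φ : Fin r → α) (v : List α) {t : List α} (ht : t.length = r) :
    ∑ a : α, occ (Fin.snoc (α := fun _ => α) φ a) (v ++ t) +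
        (if t = List.ofFn φ then 1 else 0) =
      ∑ a : α, occ (Fin.cons (α := fun _ => α) a φ) (v ++ t) +
        (if (v ++ t).take r = List.ofFn φ then 1 else 0) := by
  induction v with
  | nil => simp [occ_eq_zero _ ht.le, ← ht]
  | cons b v ih =>
    obtain ⟨ψ, hψ⟩ := exists_ofFn_eq_take (k := r) (w := v ++ t) (by simp; omega)
    obtain ⟨χ, hχ⟩ := exists_ofFn_eq_take (k := r + 1) (w := b :: (v ++ t)) (by simp; omega)
    have h1 : χ = Fin.cons (α := fun _ => α) b ψ := by
      rw [List.take_succ_cons, hψ] at hχ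
      rw [← List.ofFn_inj, ← hχ, List.ofFn_succ]
      simp
    have h2 : (b :: (v ++ t)).take r = List.ofFn (Fin.init χ) := by
      have : (b :: (v ++ t)).take r = ((b :: (v ++ t)).take (r + 1)).take r := by
        rw [List.take_take]; simp
      rw [this, hχ]
      apply List.ext_getElem
      · simp
      · intro i _ _
        simp [Fin.init, -List.ofFn_succ]
    have e1 : ∑ a : α, (if χ = Fin.snoc (α := fun _ => α) φ a
        then 1 else 0) = if Fin.init χ = φ then 1 else 0 := by
      split_ifs with h
      · rw [Finset.sum_eq_single (χ (Fin.last r))]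
        · rw [if_pos]; rw [← h]; exact (Fin.snoc_init_self χ).symm
        · intro a _ ha
          rw [if_neg]
          rintro rfl
          simp at ha
        · simp
      · refine Finset.sum_eq_zero fun a _ => if_neg ?_
        rintro rfl
        simp at h
    have e2 : ∑ a : α, (if χ = Fin.cons (α := fun _ => α) a φ
        then 1 else 0) = if ψ = φ then 1 else 0 := by
      simp only [h1]
      have : ∀ a, (Fin.cons (α := fun _ => α) b ψ = Fin.cons (α := fun _ => α) a φ) ↔
          b = a ∧ ψ = φ := fun a => Fin.cons_inj
      simp only [this]
      split_ifs with h <;> simp [h]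
    rw [hψ] at ih
    simp only [List.cons_append, occ_cons, hχ, h2, Finset.sum_add_distrib, e1, e2,
      List.ofFn_inj] at ih ⊢
    omega

/-- The initial and terminal terms of `sum_occ_snoc_add` cancel when the word starts and ends with
the same `u`. -/
theorem fr_mem_ProbSI {u w : List α} (hu : u.length = r) (hw : r < w.length)
    (hpre : u <+: w) (hsuf : u <:+ w) : fr (r + 1) w ∈ ProbSI α r := by
  classical
  refine ⟨fr_mem_Prob hw, fun φ => ?_⟩
  obtain ⟨v, rfl⟩ := hsuf
  have htake : (v ++ u).take r = u := by
    rw [← hu]; exact (List.prefix_iff_eq_take.1 hpre).symm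
  have := sum_occ_snoc_add φ v hu
  rw [htake, add_left_inj] at this
  simp only [fr_apply, ← Finset.sum_div]
  congr 1
  exact_mod_cast this.symm

end Occurrences

/-! ### Every shift-invariant measure is approximated by words -/

/-- The vectors approximated by the window frequencies of words of every large length. -/
def Realizable (α : Type u) (r : ℕ) : Set ((Fin (r + 1) → α) → ℝ) :=
  {η | ∀ ε : ℝ, 0 < ε → ∀ᶠ n : ℕ in atTop, ∃ x : List α, x.length = n ∧
    ∀ φ, |(occ φ x : ℝ) - n * η φ| ≤ ε * n}

section Realization

variable {α : Type u} {r : ℕ}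

theorem eventually_const_le_mul (C : ℝ) {ε : ℝ} (hε : 0 < ε) :
    ∀ᶠ n : ℕ in atTop, C ≤ ε * n :=
  (tendsto_natCast_atTop_atTop.const_mul_atTop hε).eventually_ge_atTop C

theorem isClosed_realizable [Fintype α] : IsClosed (Realizable α r) := by
  refine isClosed_of_closure_subset fun η hη ε hε => ?_
  obtain ⟨η', hη', hd⟩ := Metric.mem_closure_iff.1 hη (ε / 2) (by positivity)
  filter_upwards [hη' (ε / 2) (by positivity)] with n ⟨x, hx, hb⟩
  refine ⟨x, hx, fun φ => ?_⟩
  have h1 : |η φ - η' φ| ≤ ε / 2 := by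
    rw [← Real.dist_eq]; exact (dist_le_pi_dist η η' φ).trans hd.le
  have hn : (0 : ℝ) ≤ n := n.cast_nonneg
  have h2 := hb φ
  rw [abs_le] at h1 h2 ⊢
  constructor <;> nlinarith

/-- Concatenate a word of length `⌊a n⌋` for `η` with one of the remaining length for `θ`; the
junction and the rounding cost a bounded amount. -/
theorem convex_realizable [Fintype α] : Convex ℝ (Realizable α r) := by
  refine convex_iff_forall_pos.2 fun η hη θ hθ a b ha hb hab ε hε => ?_
  have hfl : ∀ {c : ℝ}, 0 < c → Tendsto (fun n : ℕ => ⌊c * n⌋₊) atTop atTop := fun hc =>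
    tendsto_nat_floor_atTop.comp (tendsto_natCast_atTop_atTop.const_mul_atTop hc)
  have hle : ∀ n : ℕ, (⌊a * n⌋₊ : ℝ) ≤ a * n := fun n => Nat.floor_le (by positivity)
  have hlt : ∀ n : ℕ, a * n < ⌊a * n⌋₊ + 1 := fun n => Nat.lt_floor_add_one _
  have hle' : ∀ n : ℕ, ⌊a * n⌋₊ ≤ n := fun n => by
    have : (⌊a * n⌋₊ : ℝ) ≤ n := (hle n).trans (by
      have : (0 : ℝ) ≤ n := n.cast_nonneg
      nlinarith)
    exact_mod_cast this
  have hsub : Tendsto (fun n : ℕ => n - ⌊a * n⌋₊) atTop atTop := by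
    refine tendsto_atTop_mono (fun n => ?_) (hfl hb)
    have : (⌊b * n⌋₊ : ℝ) ≤ ((n - ⌊a * n⌋₊ : ℕ) : ℝ) := by
      rw [Nat.cast_sub (hle' n)]
      have := Nat.floor_le (show 0 ≤ b * (n : ℝ) by positivity)
      have h2 : (n : ℝ) = a * n + b * n := by rw [← add_mul, hab, one_mul]
      linarith [hle n]
    exact_mod_cast this
  filter_upwards [(hfl ha).eventually (hη (ε / 2) (by positivity)),
    hsub.eventually (hθ (ε / 2) (by positivity)),
    eventually_const_le_mul (r + (‖η‖ + ‖θ‖)) (half_pos hε)] with n ⟨x, hx, hxb⟩ ⟨y, hy, hyb⟩ hn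
  refine ⟨x ++ y, by rw [List.length_append, hx, hy]; have := hle' n; omega, fun φ => ?_⟩
  have h1 := hxb φ
  have h2 := hyb φ
  have h3 := abs_occ_append_sub_le φ x y
  have h4 : |η φ - θ φ| ≤ ‖η‖ + ‖θ‖ :=
    (norm_sub_le (η φ) (θ φ)).trans (add_le_add (norm_le_pi_norm η φ) (norm_le_pi_norm θ φ))
  have h5 : |((⌊a * n⌋₊ : ℝ) - a * n) * (η φ - θ φ)| ≤ ‖η‖ + ‖θ‖ := by
    rw [abs_mul]
    refine (mul_le_of_le_one_left (abs_nonneg _) ?_).trans h4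
    rw [abs_le]; constructor <;> linarith [hle n, hlt n]
  rw [Nat.cast_sub (hle' n)] at h2
  have h6 : (n : ℝ) * (a • η + b • θ) φ = ⌊a * n⌋₊ * η φ + (n - ⌊a * n⌋₊) * θ φ -
      ((⌊a * n⌋₊ : ℝ) - a * n) * (η φ - θ φ) := by
    obtain rfl : b = 1 - a := by linarith
    simp only [Pi.add_apply, Pi.smul_apply, smul_eq_mul]
    ring
  rw [h6]
  rw [abs_le] at h1 h2 h3 h5 ⊢
  constructor <;> linarith

theorem occ_replicate_flatten (φ : Fin (r + 1) → α) {u : List α} (hu : u.length = r)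
    (w : List α) (j : ℕ) :
    occ φ (u ++ (List.replicate j (w ++ u)).flatten) = j * occ φ (u ++ w ++ u) := by
  induction j with
  | zero => simp [occ_eq_zero φ hu.le]
  | succ j ih =>
    have : u ++ (List.replicate (j + 1) (w ++ u)).flatten =
        (u ++ w) ++ (u ++ (List.replicate j (w ++ u)).flatten) := by
      simp [List.replicate_succ]
    rw [this, occ_append_overlap φ _ hu, ih]
    ring

/-- Repeat the cycle `w u` and fill up to length `n` with fewer than one period of arbitrary
letters. -/
theorem fr_mem_realizable [Fintype α] [Nonempty α] {u w : List α} (hu : u.length = r)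
    (hw : 0 < w.length + r) : fr (r + 1) (u ++ w ++ u) ∈ Realizable α r := by
  intro ε hε
  set l := w.length + r with hl
  have hlpos : (0 : ℝ) < l := by exact_mod_cast hw
  filter_upwards [eventually_const_le_mul (3 * r + 2 * l : ℝ) hε] with n hn
  have hdm : l * (n / l) + n % l = n := Nat.div_add_mod n l
  have hml : n % l < l := Nat.mod_lt _ hw
  generalize n / l = j at hdm
  generalize n % l = ρ at hdm hml
  set x := (List.replicate j (w ++ u)).flatten
  set y := List.replicate ρ (Classical.arbitrary α)
  refine ⟨x ++ y, by simp [x, y, hu, ← hl, ← hdm, mul_comm], fun φ => ?_⟩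
  have h1 := abs_occ_append_sub_le φ x y
  have h2 := abs_occ_append_sub_le φ u x
  rw [occ_replicate_flatten φ hu, occ_eq_zero φ hu.le] at h2
  have h3 : (occ φ y : ℝ) ≤ l := by
    have := occ_le_length φ y
    simp only [y, List.length_replicate] at this
    exact_mod_cast this.trans hml.le
  have h4 : (occ φ (u ++ w ++ u) : ℝ) ≤ l + r := by
    have := occ_le_length φ (u ++ w ++ u)
    simp only [List.length_append, hu] at this
    have h : occ φ (u ++ w ++ u) ≤ l + r := by omega
    exact_mod_cast h
  have h5 : fr (r + 1) (u ++ w ++ u) φ = occ φ (u ++ w ++ u) / l := by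
    rw [fr_apply]
    congr 1
    simp only [List.length_append, hu, hl]
    push_cast; ring
  have h6 : (n : ℝ) * fr (r + 1) (u ++ w ++ u) φ =
      j * occ φ (u ++ w ++ u) + ρ / l * occ φ (u ++ w ++ u) := by
    rw [h5, ← hdm]
    push_cast
    field_simp
  have h7 : (ρ : ℝ) / l * occ φ (u ++ w ++ u) ≤ l + r := by
    refine (mul_le_of_le_one_left (by positivity) ?_).trans h4
    rw [div_le_one hlpos]
    exact_mod_cast hml.le
  have h8 : (0 : ℝ) ≤ (ρ : ℝ) / l * occ φ (u ++ w ++ u) := by positivity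
  have h9 : (0 : ℝ) ≤ occ φ y := by positivity
  rw [h6]
  push_cast at h2
  rw [abs_le] at h1 h2 ⊢
  constructor <;> linarith

variable [Fintype α]

/-- The sum of `g` over the windows of a word. -/
noncomputable def windowSum (g : (Fin (r + 1) → α) → ℝ) (w : List α) : ℝ :=
  ∑ φ, (occ φ w : ℝ) * g φ

theorem windowSum_append_ge (g : (Fin (r + 1) → α) → ℝ) (w : List α) {u : List α}
    (hu : u.length = r) : windowSum g (w ++ u) - r * ∑ φ, |g φ| ≤ windowSum g w := by
  simp only [windowSum, Finset.mul_sum, ← Finset.sum_sub_distrib]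
  refine Finset.sum_le_sum fun φ _ => ?_
  have h := abs_occ_append_sub_le φ w u
  rw [occ_eq_zero φ hu.le] at h
  have h2 : ((occ φ (w ++ u) : ℝ) - occ φ w) * g φ ≤ r * |g φ| :=
    (le_abs_self _).trans (by
      rw [abs_mul]
      exact mul_le_mul_of_nonneg_right (by simpa using h) (abs_nonneg _))
  linarith

/-- Appending the last letter of `Φ` traverses the de Bruijn edge from its initial to its final
`r`-tuple and adds the single window `Φ`. -/
theorem windowSum_step (g : (Fin (r + 1) → α) → ℝ) (v : List α) (Φ : Fin (r + 1) → α) :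
    windowSum g (v ++ [Φ 0] ++ List.ofFn (Fin.tail Φ)) =
      windowSum g (v ++ List.ofFn (Fin.init Φ)) + g Φ := by
  classical
  have h1 : [Φ 0] ++ List.ofFn (Fin.tail Φ) = List.ofFn Φ := by
    rw [List.ofFn_succ]; rfl
  have h2 : List.ofFn Φ = List.ofFn (Fin.init Φ) ++ [Φ (Fin.last r)] := by
    rw [List.ofFn_succ', List.concat_eq_append]; rfl
  have h3 : ∀ φ, (occ φ (v ++ List.ofFn Φ) : ℝ) * g φ =
      occ φ (v ++ List.ofFn (Fin.init Φ)) * g φ + if φ = Φ then g φ else 0 := fun φ => by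
    conv_lhs => rw [h2, occ_append_overlap φ _ (by simp), ← h2, occ_ofFn]
    split_ifs <;> push_cast <;> ring
  rw [List.append_assoc, h1]
  simp [windowSum, h3, Finset.sum_add_distrib, -List.ofFn_succ]

theorem sum_mul_tail (η : (Fin (r + 1) → α) → ℝ) (h : (Fin r → α) → ℝ) :
    ∑ Φ, η Φ * h (Fin.tail Φ) =
      ∑ ψ, h ψ * ∑ a, η (Fin.cons (α := fun _ => α) a ψ) := by
  rw [← (Fin.consEquiv fun _ => α).sum_comp, Fintype.sum_prod_type_right]
  simp [Fin.consEquiv, Finset.mul_sum, mul_comm]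

theorem sum_mul_init (η : (Fin (r + 1) → α) → ℝ) (h : (Fin r → α) → ℝ) :
    ∑ Φ, η Φ * h (Fin.init Φ) =
      ∑ ψ, h ψ * ∑ a, η (Fin.snoc (α := fun _ => α) ψ a) := by
  rw [← (Fin.snocEquiv fun _ => α).sum_comp, Fintype.sum_prod_type_right]
  simp [Fin.snocEquiv, Finset.mul_sum, mul_comm]

/-- A function whose sum over every closed word is nonnegative has nonnegative mean with respect
to every shift-invariant measure. -/
theorem sum_mul_nonneg_of_closed {u : List α} (hu : u.length = r) {g : (Fin (r + 1) → α) → ℝ}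
    (hg : ∀ w, 0 ≤ windowSum g (u ++ w ++ u)) {η : (Fin (r + 1) → α) → ℝ}
    (hη : η ∈ ProbSI α r) : 0 ≤ ∑ φ, η φ * g φ := by
  -- A shortest-path potential: the least cost of a word leading from `u` to `ψ`. It is finite
  -- because closing the word up with `u` gives a nonnegative cost.
  set h : (Fin r → α) → ℝ := fun ψ => ⨅ v : List α, windowSum g (u ++ v ++ List.ofFn ψ) with hh
  have hbdd : ∀ ψ : Fin r → α,
      BddBelow (Set.range fun v : List α => windowSum g (u ++ v ++ List.ofFn ψ)) := by
    refine fun ψ => ⟨-(r * ∑ φ, |g φ|), ?_⟩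
    rintro _ ⟨v, rfl⟩
    have h1 := windowSum_append_ge g (u ++ v ++ List.ofFn ψ) hu
    have h2 := hg (v ++ List.ofFn ψ)
    rw [← List.append_assoc u v] at h2
    dsimp only
    linarith
  have hstep : ∀ Φ : Fin (r + 1) → α, h (Fin.tail Φ) - h (Fin.init Φ) ≤ g Φ := by
    intro Φ
    have : h (Fin.tail Φ) - g Φ ≤ h (Fin.init Φ) := by
      refine le_ciInf fun v => ?_
      have h1 : h (Fin.tail Φ) ≤ _ := ciInf_le (hbdd (Fin.tail Φ)) (v ++ [Φ 0])
      rw [← List.append_assoc u v, windowSum_step] at h1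
      linarith
    linarith
  -- Shift invariance says that both `r`-marginals of `η` agree, so a coboundary has mean zero.
  have hzero : ∑ Φ, η Φ * (h (Fin.tail Φ) - h (Fin.init Φ)) = 0 := by
    simp only [mul_sub, Finset.sum_sub_distrib]
    rw [sum_mul_tail, sum_mul_init, ← Finset.sum_sub_distrib]
    exact Finset.sum_eq_zero fun ψ _ => by rw [hη.2 ψ, sub_self]
  rw [← hzero]
  exact Finset.sum_le_sum fun Φ _ => mul_le_mul_of_nonneg_left (hstep Φ) (hη.1.1 Φ)

theorem nonempty_of_mem_ProbSI {η : (Fin (r + 1) → α) → ℝ} (hη : η ∈ ProbSI α r) :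
    Nonempty α := by
  by_contra hne
  rw [not_nonempty_iff] at hne
  have := hη.1.2
  simp at this

/-- Otherwise Hahn–Banach gives `f η < m < f` on the realizable vectors. Closed words have
realizable frequencies, so `f - m` has nonnegative sum over each of them, hence nonnegative mean
under `η`, a contradiction. -/
theorem ProbSI_subset_realizable : ProbSI α r ⊆ Realizable α r := by
  classical
  intro η hη
  have := nonempty_of_mem_ProbSI hη
  by_contra hnot
  obtain ⟨f, m, hfη, hf⟩ := geometric_hahn_banach_point_closed (convex_realizable (α := α) (r := r))
    isClosed_realizable hnot
  set c : (Fin (r + 1) → α) → ℝ := fun φ => f fun j => if φ = j then 1 else 0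
  have hfc : ∀ x, f x = ∑ φ, x φ * c φ := fun x =>
    LinearMap.pi_apply_eq_sum_univ (f : ((Fin (r + 1) → α) → ℝ) →ₗ[ℝ] ℝ) x
  set u := List.replicate r (Classical.arbitrary α)
  have hu : u.length = r := by simp [u]
  have key := sum_mul_nonneg_of_closed hu (g := fun φ => c φ - m) (fun w => ?_) hη
  · simp only [mul_sub, Finset.sum_sub_distrib, ← Finset.sum_mul, hη.1.2, ← hfc] at key
    linarith
  · rcases Nat.eq_zero_or_pos (w.length + r) with h0 | hpos
    · simp only [windowSum]
      refine (Finset.sum_eq_zero fun φ _ => ?_).ge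
      have : (u ++ w ++ u).length ≤ r := by
        simp only [List.length_append, hu]; omega
      rw [occ_eq_zero φ this, Nat.cast_zero, zero_mul]
    · have h1 := hf _ (fr_mem_realizable (r := r) hu hpos)
      have hP := (fr_mem_Prob (r := r) (w := u ++ w ++ u) (by simp [hu]; omega)).2
      have hl : (0 : ℝ) < ((u ++ w ++ u).length : ℝ) - r := by
        have : (0 : ℝ) < ((w.length + r : ℕ) : ℝ) := by exact_mod_cast hpos
        simp only [List.length_append, hu]
        push_cast at this ⊢
        linarith
      have h2 : windowSum (fun φ => c φ - m) (u ++ w ++ u) =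
          (((u ++ w ++ u).length : ℝ) - r) * (f (fr (r + 1) (u ++ w ++ u)) - m) := by
        have : m = ∑ φ, fr (r + 1) (u ++ w ++ u) φ * m := by rw [← Finset.sum_mul, hP, one_mul]
        rw [hfc]
        conv_rhs => rw [this]
        rw [← Finset.sum_sub_distrib, Finset.mul_sum, windowSum]
        refine Finset.sum_congr rfl fun φ _ => ?_
        rw [fr_apply]
        field_simp
      rw [h2]
      exact mul_nonneg hl.le (by linarith)

end Realization

/-! ### Extrapolation in the simplex and closeness to shift-invariant measures -/

section Simplex

theorem abs_occ_closure_sub_le {α : Type u} {r : ℕ} {u : List α} (hu : u.length = r) (w : List α)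
    (φ : Fin (r + 1) → α) : |(occ φ (u ++ w ++ u) : ℝ) - occ φ w| ≤ 2 * r := by
  have h1 := abs_occ_append_sub_le φ (u ++ w) u
  have h2 := abs_occ_append_sub_le φ u w
  rw [occ_eq_zero φ hu.le] at h1 h2
  push_cast at h1 h2
  rw [abs_le] at h1 h2 ⊢
  constructor <;> linarith

variable {α : Type u} [Fintype α] {r : ℕ}

theorem le_one_of_mem_Prob {k : ℕ} {η : (Fin k → α) → ℝ} (hη : η ∈ Prob α k) (φ : Fin k → α) :
    η φ ≤ 1 :=
  hη.2 ▸ Finset.single_le_sum (fun ψ _ => hη.1 ψ) (Finset.mem_univ φ)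

theorem convex_ProbSI : Convex ℝ (ProbSI α r) := by
  intro x hx y hy a b ha hb hab
  refine ⟨convex_stdSimplex ℝ _ hx.1 hy.1 ha hb hab, fun φ => ?_⟩
  simp only [Pi.add_apply, Pi.smul_apply, smul_eq_mul, Finset.sum_add_distrib, ← Finset.mul_sum,
    hx.2 φ, hy.2 φ]

theorem isClosed_ProbSI : IsClosed (ProbSI α r) := by
  have : ProbSI α r = Prob α (r + 1) ∩ ⋂ φ : Fin r → α,
      {η | ∑ a : α, η (Fin.cons (α := fun _ => α) a φ) =
        ∑ a : α, η (Fin.snoc (α := fun _ => α) φ a)} := by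
    ext η; simp [ProbSI]
  rw [this]
  refine (isClosed_stdSimplex ℝ _).inter (isClosed_iInter fun φ => isClosed_eq ?_ ?_)
  · exact continuous_finsetSum _ fun a _ => continuous_apply _
  · exact continuous_finsetSum _ fun a _ => continuous_apply _

theorem isCompact_ProbSI : IsCompact (ProbSI α r) :=
  (isCompact_stdSimplex ℝ _).of_isClosed_subset isClosed_ProbSI fun _ h => h.1

/-- The point is the `y` solving `z = a s + (1 - a) y`; its total mass is automatically one, and
nonnegativity is exactly `hle`. -/
theorem extrapolate_mem_Prob {k : ℕ} {z s : (Fin k → α) → ℝ} (hz : z ∈ Prob α k)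
    (hs : s ∈ Prob α k) {a : ℝ} (ha : a < 1) (hle : ∀ φ, a * s φ ≤ z φ) :
    (1 - a)⁻¹ • (z - a • s) ∈ Prob α k := by
  have h1 : 0 < 1 - a := by linarith
  refine ⟨fun φ => mul_nonneg (inv_nonneg.2 h1.le) ?_, ?_⟩
  · simpa using hle φ
  · simp only [Pi.smul_apply, Pi.sub_apply, smul_eq_mul]
    rw [← Finset.mul_sum, Finset.sum_sub_distrib, ← Finset.mul_sum, hz.2, hs.2]
    field_simp

theorem extrapolate_mem_ProbSI {z s : (Fin (r + 1) → α) → ℝ} (hz : z ∈ ProbSI α r)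
    (hs : s ∈ ProbSI α r) {a : ℝ} (ha : a < 1) (hle : ∀ φ, a * s φ ≤ z φ) :
    (1 - a)⁻¹ • (z - a • s) ∈ ProbSI α r := by
  refine ⟨extrapolate_mem_Prob hz.1 hs.1 ha hle, fun φ => ?_⟩
  simp only [Pi.smul_apply, Pi.sub_apply, smul_eq_mul, ← Finset.mul_sum, Finset.sum_sub_distrib,
    hz.2 φ, hs.2 φ]

theorem uniform_mem_ProbSI [Nonempty α] :
    (fun _ => (Fintype.card (Fin (r + 1) → α) : ℝ)⁻¹) ∈ ProbSI α r := by
  classical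
  have : (Fintype.card (Fin (r + 1) → α) : ℝ) ≠ 0 := by
    exact_mod_cast Fintype.card_ne_zero
  refine ⟨⟨fun _ => by positivity, ?_⟩, fun _ => rfl⟩
  rw [Finset.sum_const, Finset.card_univ, nsmul_eq_mul, mul_inv_cancel₀ this]

/-- A ball around a shift-invariant measure contains a smaller ball around a strictly positive
one. -/
theorem exists_positive_center {Q Γ : Set ((Fin (r + 1) → α) → ℝ)}
    {η : (Fin (r + 1) → α) → ℝ} (hη : η ∈ ProbSI α r) {ρ : ℝ} (hρ : 0 < ρ)
    (h : ∀ y ∈ Q, dist y η < ρ → y ∈ Γ) :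
    ∃ η₀ ∈ ProbSI α r, ∃ t : ℝ, 0 < t ∧ (∀ φ, t ≤ η₀ φ) ∧ ∀ y ∈ Q, dist y η₀ ≤ t → y ∈ Γ := by
  classical
  have := nonempty_of_mem_ProbSI hη
  set v : (Fin (r + 1) → α) → ℝ := fun _ => (Fintype.card (Fin (r + 1) → α) : ℝ)⁻¹ with hv
  have hvSI : v ∈ ProbSI α r := uniform_mem_ProbSI
  have hcard : (0 : ℝ) < (Fintype.card (Fin (r + 1) → α) : ℝ)⁻¹ :=
    inv_pos.2 (by exact_mod_cast Fintype.card_pos)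
  -- Mixing in weight `σ` of the uniform measure moves the centre by at most `ρ / 2` and makes every
  -- coordinate at least `σ` over the number of tuples; a radius of at most `ρ / 4` then stays
  -- inside the old ball.
  set σ : ℝ := min 1 (ρ / 2)
  have hσ : 0 < σ := by positivity
  have hσ1 : σ ≤ 1 := min_le_left _ _
  have hσρ : σ ≤ ρ / 2 := min_le_right _ _
  refine ⟨(1 - σ) • η + σ • v, convex_ProbSI hη hvSI (by linarith) hσ.le (by ring),
    min (ρ / 4) (σ * (Fintype.card (Fin (r + 1) → α) : ℝ)⁻¹), by positivity, fun φ => ?_,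
    fun y hy hd => h y hy ?_⟩
  · refine (min_le_right _ _).trans ?_
    have : 0 ≤ (1 - σ) * η φ := mul_nonneg (by linarith) (hη.1.1 φ)
    simpa [hv] using this
  · have h1 : dist ((1 - σ) • η + σ • v) η ≤ ρ / 2 := by
      refine (dist_pi_le_iff (by positivity)).2 fun φ => ?_
      have e : ((1 - σ) • η + σ • v) φ - η φ = σ * (v φ - η φ) := by
        simp only [Pi.add_apply, Pi.smul_apply, smul_eq_mul]; ring
      rw [Real.dist_eq, e, abs_mul, abs_of_pos hσ]
      have : |v φ - η φ| ≤ 1 := by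
        have h1 := hvSI.1.1 φ
        have h2 := hη.1.1 φ
        have h3 := le_one_of_mem_Prob hvSI.1 φ
        have h4 := le_one_of_mem_Prob hη.1 φ
        rw [abs_le]; constructor <;> linarith
      nlinarith
    have h2 : dist y ((1 - σ) • η + σ • v) ≤ ρ / 4 := hd.trans (min_le_left _ _)
    linarith [dist_triangle y ((1 - σ) • η + σ • v) η]

/-- The error of `z` is charged to the `η₀` end: `z = a s + (1 - a) y` with `y` within `t` of `η₀`,
and `t ≤ η₀` keeps `y` nonnegative. The set `Q` is either the shift-invariant measures or the whole
simplex. -/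
theorem mem_of_near_combination {Q Γ : Set ((Fin (r + 1) → α) → ℝ)} (hΓ : Convex ℝ Γ)
    (hQ : ∀ z ∈ Q, ∀ s ∈ Q, ∀ a : ℝ, a < 1 → (∀ φ, a * s φ ≤ z φ) → (1 - a)⁻¹ • (z - a • s) ∈ Q)
    {η₀ : (Fin (r + 1) → α) → ℝ} {t : ℝ} (ht : 0 ≤ t) (hpos : ∀ φ, t ≤ η₀ φ)
    (hball : ∀ y ∈ Q, dist y η₀ ≤ t → y ∈ Γ) {s z : (Fin (r + 1) → α) → ℝ} (hs : s ∈ Γ)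
    (hsQ : s ∈ Q) (hz : z ∈ Q) {a : ℝ} (ha0 : 0 ≤ a) (ha : a < 1)
    (hd : ∀ φ, |z φ - (a * s φ + (1 - a) * η₀ φ)| ≤ (1 - a) * t) : z ∈ Γ := by
  have h1 : 0 < 1 - a := by linarith
  have hle : ∀ φ, a * s φ ≤ z φ := fun φ => by
    have := (abs_le.1 (hd φ)).1
    nlinarith [hpos φ]
  have hy : (1 - a)⁻¹ • (z - a • s) ∈ Γ := by
    refine hball _ (hQ z hz s hsQ a ha hle) ((dist_pi_le_iff ht).2 fun φ => ?_)
    have e : ((1 - a)⁻¹ • (z - a • s)) φ - η₀ φ =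
        (1 - a)⁻¹ * (z φ - (a * s φ + (1 - a) * η₀ φ)) := by
      simp only [Pi.smul_apply, Pi.sub_apply, smul_eq_mul]
      field_simp
      ring
    rw [Real.dist_eq, e, abs_mul, abs_of_pos (inv_pos.2 h1), inv_mul_le_iff₀ h1]
    exact hd φ
  have e : z = a • s + (1 - a) • ((1 - a)⁻¹ • (z - a • s)) := by
    rw [smul_smul, mul_inv_cancel₀ h1.ne', one_smul]; abel
  rw [e]
  exact hΓ hs hy ha0 h1.le (by ring)

theorem abs_occ_sub_length_mul_fr_le {w : List α} (hw : r < w.length) (φ : Fin (r + 1) → α) :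
    |(occ φ w : ℝ) - w.length * fr (r + 1) w φ| ≤ r := by
  have h0 : (0 : ℝ) < (w.length : ℝ) - r := by
    have : (r : ℝ) < w.length := by exact_mod_cast hw
    linarith
  have h1 : (occ φ w : ℝ) = ((w.length : ℝ) - r) * fr (r + 1) w φ := by
    rw [fr_apply]; field_simp
  have h2 := (fr_mem_Prob hw).1 φ
  have h3 := le_one_of_mem_Prob (fr_mem_Prob hw) φ
  have hr : (0 : ℝ) ≤ r := r.cast_nonneg
  rw [h1, abs_le]
  constructor <;> nlinarith

/-- A shift-invariant measure close to the compact set `Γ` is close to a shift-invariant measure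
in `Γ`. -/
theorem exists_near_inter {Γ : Set ((Fin (r + 1) → α) → ℝ)} (hclosed : IsClosed Γ) {κ : ℝ}
    (hκ : 0 < κ) :
    ∃ τ : ℝ, 0 < τ ∧ ∀ y ∈ ProbSI α r, ∀ γ ∈ Γ, dist y γ < τ →
      ∃ s ∈ Γ ∩ ProbSI α r, dist y s < κ := by
  -- This compact set misses the closed set `Γ`, so the two have positive distance.
  have hK : IsCompact (ProbSI α r \ Metric.thickening κ (Γ ∩ ProbSI α r)) :=
    isCompact_ProbSI.diff Metric.isOpen_thickening
  have hdisj : Disjoint (ProbSI α r \ Metric.thickening κ (Γ ∩ ProbSI α r)) Γ :=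
    Set.disjoint_left.2 fun y hy hyΓ =>
      hy.2 (Metric.self_subset_thickening hκ _ ⟨hyΓ, hy.1⟩)
  obtain ⟨τ, hτ, hd⟩ := hdisj.exists_thickenings hK hclosed
  refine ⟨τ, hτ, fun y hy γ hγ hyγ => ?_⟩
  by_contra hnot
  refine Set.disjoint_left.1 hd (Metric.self_subset_thickening hτ _ ⟨hy, fun hy' => hnot ?_⟩)
    (Metric.mem_thickening_iff.2 ⟨γ, hγ, hyγ⟩)
  exact Metric.mem_thickening_iff.1 hy'

/-- Closing `w` to `u w u` makes its distribution shift-invariant while moving it by `O(r / n)`;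
`exists_near_inter` then supplies `s`. -/
theorem eventually_admissible_near [Nonempty α] {Γ : Set ((Fin (r + 1) → α) → ℝ)}
    (hclosed : IsClosed Γ) {κ : ℝ} (hκ : 0 < κ) :
    ∀ᶠ n : ℕ in atTop, ∀ w ∈ admissibleOfLength n Γ, ∃ s ∈ Γ ∩ ProbSI α r,
      ∀ φ, |(occ φ w : ℝ) - n * s φ| ≤ κ * n := by
  obtain ⟨τ, hτ, hnear⟩ := exists_near_inter hclosed (half_pos hκ)
  set u := List.replicate r (Classical.arbitrary α)
  have hu : u.length = r := by simp [u]
  filter_upwards [eventually_const_le_mul (6 * r) (half_pos hτ),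
    eventually_const_le_mul (5 * r) (half_pos hκ), eventually_gt_atTop (r + 1)]
    with n h1 h2 hn w hw
  obtain ⟨⟨_, hwΓ⟩, hwn⟩ := hw
  have hpre : u <+: u ++ w ++ u := by rw [List.append_assoc]; exact List.prefix_append _ _
  have hlen : (u ++ w ++ u).length = n + 2 * r := by
    simp only [List.length_append, hu, hwn]; omega
  have hSI := fr_mem_ProbSI hu (by rw [hlen]; omega) hpre (List.suffix_append (u ++ w) u)
  have hn0 : (0 : ℝ) < n := by exact_mod_cast (by omega : 0 < n)
  have key : ∀ φ, |(n : ℝ) * (fr (r + 1) (u ++ w ++ u) φ - fr (r + 1) w φ)| ≤ 6 * r ∧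
      |(occ φ w : ℝ) - n * fr (r + 1) (u ++ w ++ u) φ| ≤ 5 * r := by
    intro φ
    have e1 := abs_occ_sub_length_mul_fr_le (r := r) (w := w) (by omega) φ
    have e2 := abs_occ_sub_length_mul_fr_le (r := r) (w := u ++ w ++ u) (by rw [hlen]; omega) φ
    have e3 := abs_occ_closure_sub_le hu w φ
    have e4 := hSI.1.1 φ
    have e5 := le_one_of_mem_Prob hSI.1 φ
    have hr : (0 : ℝ) ≤ r := r.cast_nonneg
    rw [hlen] at e2
    rw [hwn] at e1
    push_cast at e2
    have e6 : (r : ℝ) * fr (r + 1) (u ++ w ++ u) φ ≤ r := mul_le_of_le_one_right hr e5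
    have e7 : 0 ≤ (r : ℝ) * fr (r + 1) (u ++ w ++ u) φ := mul_nonneg hr e4
    rw [abs_le] at e1 e2 e3
    constructor <;> rw [abs_le] <;> constructor <;> linarith
  have hdist : dist (fr (r + 1) (u ++ w ++ u)) (fr (r + 1) w) ≤ τ / 2 := by
    refine (dist_pi_le_iff (half_pos hτ).le).2 fun φ => ?_
    have e1 := (key φ).1
    rw [abs_mul, abs_of_pos hn0] at e1
    rw [Real.dist_eq]
    nlinarith
  obtain ⟨s, hs, hd⟩ := hnear _ hSI _ hwΓ (by linarith)
  refine ⟨s, hs, fun φ => ?_⟩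
  have e1 := (key φ).2
  have e2 := (dist_le_pi_dist _ _ φ).trans hd.le
  rw [Real.dist_eq, abs_le] at e2
  rw [abs_le] at e1 ⊢
  constructor <;> nlinarith

end Simplex

/-! ### Empirical distributions of concatenated blocks -/

section Concatenation

variable {α : Type u} {r : ℕ}

theorem length_flatten_of_forall {m : ℕ} {ws : List (List α)} (h : ∀ w ∈ ws, w.length = m) :
    ws.flatten.length = ws.length * m := by
  rw [List.length_flatten, List.map_congr_left h, List.map_const', List.sum_replicate,
    smul_eq_mul]

theorem sum_occ_le_occ_flatten (φ : Fin (r + 1) → α) (ws : List (List α)) :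
    (ws.map (occ φ)).sum ≤ occ φ ws.flatten := by
  induction ws with
  | nil => simp
  | cons w ws ih =>
    rw [List.map_cons, List.sum_cons, List.flatten_cons]
    exact (Nat.add_le_add_left ih _).trans (occ_add_le_occ_append φ _ _)

/-- The points `s` of the individual blocks are averaged into one point of the convex set `S`; each
junction costs at most `r`. -/
theorem flatten_near_combination {S : Set ((Fin (r + 1) → α) → ℝ)} (hS : Convex ℝ S)
    (hne : S.Nonempty) {A B E : ℝ} {η₀ : (Fin (r + 1) → α) → ℝ} (ws : List (List α))
    (h : ∀ w ∈ ws, ∃ s ∈ S, ∀ φ, |(occ φ w : ℝ) - (A * s φ + B * η₀ φ)| ≤ E) :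
    ∃ s ∈ S, ∀ φ, |(occ φ ws.flatten : ℝ) - ws.length * (A * s φ + B * η₀ φ)| ≤
      ws.length * (E + r) := by
  induction ws with
  | nil =>
    obtain ⟨s, hs⟩ := hne
    exact ⟨s, hs, fun φ => by simp⟩
  | cons w ws ih =>
    obtain ⟨s₁, hs₁, h₁⟩ := h w (by simp)
    obtain ⟨s₂, hs₂, h₂⟩ := ih fun v hv => h v (by simp [hv])
    set j : ℝ := (ws.length : ℝ) with hj
    have hj0 : 0 ≤ j := by positivity
    have hj1 : (0 : ℝ) < j + 1 := by positivity
    refine ⟨(1 / (j + 1)) • s₁ + (j / (j + 1)) • s₂,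
      hS hs₁ hs₂ (by positivity) (by positivity) (by field_simp; ring), fun φ => ?_⟩
    have e1 := h₁ φ
    have e2 := h₂ φ
    have e3 := abs_occ_append_sub_le φ w ws.flatten
    have e4 : (((w :: ws).length : ℕ) : ℝ) = j + 1 := by simp [hj]
    have e5 : (j + 1) * (A * ((1 / (j + 1)) • s₁ + (j / (j + 1)) • s₂) φ + B * η₀ φ) =
        (A * s₁ φ + B * η₀ φ) + j * (A * s₂ φ + B * η₀ φ) := by
      simp only [Pi.add_apply, Pi.smul_apply, smul_eq_mul]
      field_simp
      ring
    rw [e4, e5, List.flatten_cons]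
    rw [abs_le] at e1 e2 e3 ⊢
    constructor <;> linarith

variable [Fintype α]

theorem fr_flatten_append_near {S : Set ((Fin (r + 1) → α) → ℝ)} (hS : Convex ℝ S)
    (hSP : S ⊆ Prob α (r + 1)) {n n' : ℕ} (hn : 0 < n) {κ : ℝ}
    (hκ : 5 * r ≤ κ * n) {η₀ : (Fin (r + 1) → α) → ℝ} (hη₀ : η₀ ∈ Prob α (r + 1))
    {ws : List (List α)} (hws : ws ≠ [])
    (h : ∀ w ∈ ws, w.length = n + n' + 2 * r ∧
      ∃ s ∈ S, ∀ φ, |(occ φ w : ℝ) - (n * s φ + n' * η₀ φ)| ≤ κ * n)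
    {y : List α} (hy : 2 * y.length ≤ κ * n * ws.length) :
    ∃ s ∈ S, ∀ φ, |fr (r + 1) (ws.flatten ++ y) φ -
      ((n / (n + n') : ℝ) * s φ + (1 - (n / (n + n') : ℝ)) * η₀ φ)| ≤ 3 * κ := by
  have hSne : S.Nonempty := by
    obtain ⟨w, hw⟩ := List.exists_mem_of_ne_nil ws hws
    obtain ⟨s, hs, _⟩ := (h w hw).2
    exact ⟨s, hs⟩
  obtain ⟨s, hs, hb⟩ := flatten_near_combination hS hSne ws fun w hw => (h w hw).2
  refine ⟨s, hs, fun φ => ?_⟩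
  have hlen := length_flatten_of_forall fun w hw => (h w hw).1
  have hj : 1 ≤ ws.length := List.length_pos_iff.2 hws
  set j := ws.length
  have hj' : (1 : ℝ) ≤ j := by exact_mod_cast hj
  have hn0 : (0 : ℝ) < n := by exact_mod_cast hn
  have hL : ((ws.flatten ++ y).length : ℝ) = j * (n + n' + 2 * r) + y.length := by
    rw [List.length_append, hlen]; push_cast; ring
  have hr : (0 : ℝ) ≤ r := r.cast_nonneg
  have hy0 : (0 : ℝ) ≤ y.length := y.length.cast_nonneg
  have hn'0 : (0 : ℝ) ≤ n' := n'.cast_nonneg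
  have hjr : (r : ℝ) ≤ j * r := le_mul_of_one_le_left hr hj'
  have hjn : 0 < (j : ℝ) * n := by positivity
  have hjn' : 0 ≤ (j : ℝ) * n' := by positivity
  set D : ℝ := ((ws.flatten ++ y).length : ℝ) - r with hD
  have hDge : (j : ℝ) * n ≤ D := by rw [hD, hL]; nlinarith
  set z : ℝ := (n / (n + n') : ℝ) * s φ + (1 - (n / (n + n') : ℝ)) * η₀ φ with hz
  have hz1 : (n + n' : ℝ) * z = n * s φ + n' * η₀ φ := by
    rw [hz]; field_simp; ring
  have hz0 : 0 ≤ z := by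
    have h1 := (hSP hs).1 φ
    have h2 := hη₀.1 φ
    have : 0 ≤ (n + n' : ℝ) * z := by rw [hz1]; positivity
    exact nonneg_of_mul_nonneg_right this (by positivity)
  have hz2 : z ≤ 1 := by
    have h1 := le_one_of_mem_Prob (hSP hs) φ
    have h2 := le_one_of_mem_Prob hη₀ φ
    have : (n + n' : ℝ) * z ≤ (n + n') * 1 := by rw [hz1]; nlinarith
    exact le_of_mul_le_mul_left this (by positivity)
  have e1 := hb φ
  have e2 := abs_occ_append_sub_le φ ws.flatten y
  have e3 : (occ φ y : ℝ) ≤ y.length := by exact_mod_cast occ_le_length φ y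
  have e4 : (0 : ℝ) ≤ occ φ y := by positivity
  rw [← hz1] at e1
  -- Three errors of at most `κ n j` each: the blocks themselves, the junctions and the copies of
  -- `u`, and the tail `y`; and `j n ≤ D`.
  have e5 : |(occ φ (ws.flatten ++ y) : ℝ) - D * z| ≤ 3 * κ * D := by
    have e6 : D * z = j * ((n + n') * z) + (2 * (j * r) + y.length - r) * z := by
      rw [hD, hL]; ring
    have e7 : (2 * (j * r) + y.length - r) * z ≤ (2 * (j * r) + y.length - r) :=
      mul_le_of_le_one_right (by linarith) hz2
    have e8 : 0 ≤ (2 * (j * r) + y.length - r) * z := mul_nonneg (by linarith) hz0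
    have e9 : j * (5 * r) ≤ j * (κ * n) := mul_le_mul_of_nonneg_left hκ (by linarith)
    have hκ0 : 0 ≤ κ := by
      have : 0 ≤ κ * n := by linarith
      exact nonneg_of_mul_nonneg_left this hn0
    have e10 : κ * (j * n) ≤ κ * D := mul_le_mul_of_nonneg_left hDge hκ0
    rw [abs_le] at e1 e2 ⊢
    rw [e6]
    constructor <;> nlinarith
  have hDpos : 0 < D := hjn.trans_le hDge
  rw [fr_apply, ← hD, div_sub' hDpos.ne', abs_div, abs_of_pos hDpos, div_le_iff₀ hDpos]
  exact e5

/-- A concatenation of words of equal length whose empirical distributions lie deep inside a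
convex set has its empirical distribution in that set. -/
theorem fr_flatten_mem {Γ : Set ((Fin (r + 1) → α) → ℝ)} (hΓ : Convex ℝ Γ) {m : ℕ} (hm : r < m)
    {ε : ℝ} (hε : (r : ℝ) ≤ ε * m) {ws : List (List α)} (hws : ws ≠ [])
    (h : ∀ w ∈ ws, w.length = m ∧ ∀ p ∈ Prob α (r + 1), dist p (fr (r + 1) w) ≤ ε → p ∈ Γ) :
    fr (r + 1) ws.flatten ∈ Γ := by
  have hlen := length_flatten_of_forall fun w hw => (h w hw).1
  have hs : 1 ≤ ws.length := List.length_pos_iff.2 hws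
  set s := ws.length with hsdef
  have hs' : (1 : ℝ) ≤ s := by exact_mod_cast hs
  have hm' : (r : ℝ) < m := by exact_mod_cast hm
  have hr : (0 : ℝ) ≤ r := r.cast_nonneg
  have hm0 : (0 : ℝ) < m := by linarith
  -- The windows crossing a junction, `(s - 1) r` in total.
  set D : (Fin (r + 1) → α) → ℝ := fun φ => occ φ ws.flatten - ((ws.map (occ φ)).sum : ℕ)
  have hD0 : ∀ φ, 0 ≤ D φ := fun φ => sub_nonneg.2 (by exact_mod_cast sum_occ_le_occ_flatten φ ws)
  have hrs : r ≤ ws.flatten.length := by rw [hlen]; nlinarith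
  have hmass : ∀ w : List α, r ≤ w.length → ∑ φ : Fin (r + 1) → α, (occ φ w : ℝ) =
      w.length - r := fun w hw => by
    have := sum_occ (r := r) hw
    rw [eq_sub_iff_add_eq]
    exact_mod_cast this
  have hsum : ∑ φ, D φ = (s - 1) * r := by
    have h1 : ∑ φ : Fin (r + 1) → α, (((ws.map (occ φ)).sum : ℕ) : ℝ) = s * (m - r) := by
      have : ∀ φ : Fin (r + 1) → α, (((ws.map (occ φ)).sum : ℕ) : ℝ) =
          ∑ i : Fin ws.length, (occ φ ws[i] : ℝ) := fun φ => by
        rw [← Fin.sum_univ_fun_getElem]; push_cast; rfl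
      simp only [this]
      rw [Finset.sum_comm, Finset.sum_congr rfl (g := fun _ => (m : ℝ) - r)]
      · simp [hsdef]; ring
      · intro i _
        have hi : (ws[i]).length = m := (h _ (List.getElem_mem _)).1
        rw [hmass _ (by omega), hi]
    rw [Finset.sum_sub_distrib, hmass _ hrs, h1, hlen]
    push_cast; ring
  have hDle : ∀ φ, D φ ≤ (s - 1) * r := fun φ => by
    rw [← hsum]; exact Finset.single_le_sum (fun ψ _ => hD0 ψ) (Finset.mem_univ φ)
  have hden : (0 : ℝ) < s * m - r := by nlinarith
  -- The junction windows are shared equally among the blocks. Each `p w` is a probability measure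
  -- within `r / m ≤ ε` of the distribution of `w`, and their average is the distribution of the
  -- concatenation.
  set p : List α → (Fin (r + 1) → α) → ℝ := fun w φ => (s * occ φ w + D φ) / (s * m - r)
  have hp : ∀ w ∈ ws, p w ∈ Γ := by
    intro w hw
    obtain ⟨hwm, hball⟩ := h w hw
    refine hball _ ⟨fun φ => ?_, ?_⟩ ((dist_pi_le_iff ?_).2 fun φ => ?_)
    · have := hD0 φ
      positivity
    · rw [← Finset.sum_div, Finset.sum_add_distrib, hsum, ← Finset.mul_sum,
        hmass w (by omega), hwm, div_eq_one_iff_eq hden.ne']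
      ring
    · by_contra hneg
      nlinarith
    · have hfr := fr_mem_Prob (r := r) (w := w) (by omega)
      have h0 := hfr.1 φ
      have h1 := le_one_of_mem_Prob hfr φ
      have hocc : (occ φ w : ℝ) = (m - r) * fr (r + 1) w φ := by
        have : (m : ℝ) - r ≠ 0 := by linarith
        rw [fr_apply, hwm]; field_simp
      have e : p w φ - fr (r + 1) w φ =
          (D φ - (s - 1) * r * fr (r + 1) w φ) / (s * m - r) := by
        simp only [p]
        rw [hocc]; field_simp; ring
      have hsr : 0 ≤ (s - 1) * (r : ℝ) := mul_nonneg (by linarith) hr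
      rw [Real.dist_eq, e, abs_div, abs_of_pos hden, div_le_iff₀ hden]
      have e1 : |D φ - (s - 1) * r * fr (r + 1) w φ| ≤ (s - 1) * r := by
        have h2 := hD0 φ
        have h3 := hDle φ
        have h4 := mul_le_of_le_one_right hsr h1
        have h5 := mul_nonneg hsr h0
        rw [abs_le]; constructor <;> linarith
      refine e1.trans ?_
      have e2 : (s - 1) * (r : ℝ) * m ≤ r * (s * m - r) := by nlinarith
      have e3 : (r : ℝ) * (s * m - r) ≤ ε * m * (s * m - r) :=
        mul_le_mul_of_nonneg_right hε hden.le
      have e4 : (s - 1) * (r : ℝ) * m ≤ ε * (s * m - r) * m := by linarith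
      exact le_of_mul_le_mul_right e4 hm0
  have havg : fr (r + 1) ws.flatten = ∑ i : Fin ws.length, (1 / s : ℝ) • p ws[i] := by
    ext φ
    have h1 : (((ws.map (occ φ)).sum : ℕ) : ℝ) = ∑ i : Fin ws.length, (occ φ ws[i] : ℝ) := by
      rw [← Fin.sum_univ_fun_getElem]; push_cast; rfl
    simp only [Finset.sum_apply, Pi.smul_apply, smul_eq_mul, p, ← Finset.mul_sum,
      ← Finset.sum_div, Finset.sum_add_distrib]
    rw [← h1, fr_apply, hlen, Finset.sum_const, Finset.card_univ, Fintype.card_fin, ← hsdef]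
    simp only [D, nsmul_eq_mul]
    push_cast
    field_simp
    ring
  rw [havg]
  refine hΓ.sum_mem (fun _ _ => by positivity) ?_ fun i _ => hp _ (List.getElem_mem _)
  rw [Finset.sum_const, Finset.card_univ, Fintype.card_fin, ← hsdef, nsmul_eq_mul]
  field_simp

/-- Blocks that consist of one long admissible word and a shorter word with prescribed window
frequencies, between two copies of `u`. -/
theorem eventually_exists_blocks {Γ : Set ((Fin (r + 1) → α) → ℝ)} (hclosed : IsClosed Γ)
    {η₀ : (Fin (r + 1) → α) → ℝ} (hη₀ : η₀ ∈ ProbSI α r) {u : List α} (hu : u.length = r)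
    {J : ℕ} (hJ : 0 < J) {κ : ℝ} (hκ : 0 < κ) :
    ∀ᶠ n : ℕ in atTop, ∃ T : Set (List α), T.ncard = (admissibleOfLength n Γ).ncard ∧
      ∀ b ∈ T, b.length = n + (n / J + 1) + 2 * r ∧ u <+: b ∧ u <:+ b ∧
        ∃ s ∈ Γ ∩ ProbSI α r, ∀ φ,
          |(occ φ b : ℝ) - (n * s φ + (n / J + 1 : ℕ) * η₀ φ)| ≤ κ * n := by
  have := nonempty_of_mem_ProbSI hη₀
  have htend : Tendsto (fun n : ℕ => n / J + 1) atTop atTop :=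
    tendsto_atTop_mono (fun n => Nat.le_succ _) (Nat.tendsto_div_const_atTop hJ.ne')
  filter_upwards [eventually_admissible_near hclosed (κ := κ / 4) (by positivity),
    htend.eventually (ProbSI_subset_realizable hη₀ (κ / 4) (by positivity)),
    eventually_const_le_mul (3 * r) (ε := κ / 4) (by positivity), eventually_ge_atTop 1]
    with n h1 ⟨x, hx, hxb⟩ h3 hn
  refine ⟨(fun w => u ++ w ++ x ++ u) '' admissibleOfLength n Γ, ?_, ?_⟩
  -- The filler `x` is the same for all `w`, so no words are lost.
  · refine Set.ncard_image_of_injective _ fun w w' hww => ?_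
    simpa using hww
  · rintro _ ⟨w, hw, rfl⟩
    obtain ⟨s, hs, hsb⟩ := h1 w hw
    refine ⟨?_, ?_, List.suffix_append _ u, s, hs, fun φ => ?_⟩
    · simp only [List.length_append, hu, hw.2, hx]; omega
    · simp only [List.append_assoc]; exact List.prefix_append _ _
    · have e1 := hsb φ
      have e2 := hxb φ
      have e3 := abs_occ_closure_sub_le hu (w ++ x) φ
      rw [← List.append_assoc] at e3
      have e4 := abs_occ_append_sub_le φ w x
      have e5 : ((n / J + 1 : ℕ) : ℝ) ≤ 2 * n := by
        have : n / J ≤ n := Nat.div_le_self _ _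
        exact_mod_cast (by omega : n / J + 1 ≤ 2 * n)
      dsimp only
      generalize ((n / J + 1 : ℕ) : ℝ) = N at *
      rw [abs_le] at e1 e2 e3 e4 ⊢
      constructor <;> nlinarith

end Concatenation

/-! ### Capacity of free concatenations and single-state encoders -/

section Capacity

variable {α : Type u}

theorem mul_log2_of_pos (n : ℕ) {c : ℕ} (hc : 0 < c) :
    ((1 / (n : ℝ) : ℝ) : EReal) * log2 c = ((Real.logb 2 c / n : ℝ) : EReal) := by
  rw [log2, if_neg hc.ne', ← EReal.coe_mul]
  congr 1; ring

theorem mul_log2_zero {n : ℕ} (hn : 0 < n) : ((1 / (n : ℝ) : ℝ) : EReal) * log2 0 = ⊥ := by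
  rw [log2, if_pos rfl]
  exact EReal.coe_mul_bot_of_pos (by positivity)

theorem log2_mono {c d : ℕ} (h : c ≤ d) : log2 c ≤ log2 d := by
  rcases Nat.eq_zero_or_pos c with rfl | hc
  · simp [log2]
  · rw [log2, log2, if_neg hc.ne', if_neg (hc.trans_le h).ne', EReal.coe_le_coe_iff]
    exact Real.logb_le_logb_of_le one_lt_two (by exact_mod_cast hc) (by exact_mod_cast h)

theorem finite_ofLength [Finite α] (S : Set (List α)) (n : ℕ) :
    {w ∈ S | w.length = n}.Finite :=
  (List.finite_length_eq α n).subset fun _ hw => hw.2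

theorem capacity_mono_of_eventually [Finite α] {S S' : Set (List α)}
    (h : ∀ᶠ n : ℕ in atTop, ∀ w ∈ S, w.length = n → w ∈ S') : capacity S ≤ capacity S' := by
  refine limsup_le_limsup ?_
  filter_upwards [h] with n hn
  refine mul_le_mul_of_nonneg_left (log2_mono (Set.ncard_le_ncard (fun w hw => ?_)
    (finite_ofLength S' n))) (by exact_mod_cast (by positivity : (0 : ℝ) ≤ 1 / n))
  exact ⟨hn w hw.1 hw.2, hw.2⟩

theorem capacity_congr_of_eventually [Finite α] {S S' : Set (List α)}
    (h : ∀ᶠ n : ℕ in atTop, ∀ w : List α, w.length = n → (w ∈ S ↔ w ∈ S')) :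
    capacity S = capacity S' :=
  le_antisymm (capacity_mono_of_eventually (h.mono fun _ hn w hw hl => (hn w hl).1 hw))
    (capacity_mono_of_eventually (h.mono fun _ hn w hw hl => (hn w hl).2 hw))

theorem capacity_nonneg_of_frequently [Finite α] {S : Set (List α)}
    (h : ∃ᶠ n : ℕ in atTop, ∃ w ∈ S, w.length = n) : 0 ≤ capacity S := by
  refine le_limsup_of_frequently_le (h.mono fun n hn => ?_)
  obtain ⟨w, hw, hl⟩ := hn
  have hpos : 0 < {w ∈ S | w.length = n}.ncard :=
    (Set.ncard_pos (finite_ofLength S n)).2 ⟨w, hw, hl⟩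
  rw [mul_log2_of_pos n hpos]
  have : (0 : ℝ) ≤ Real.logb 2 {w ∈ S | w.length = n}.ncard / n :=
    div_nonneg (Real.logb_nonneg one_lt_two (by exact_mod_cast hpos)) n.cast_nonneg
  exact_mod_cast this

theorem capacity_le_card [Fintype α] (S : Set (List α)) :
    capacity S ≤ ((Real.logb 2 (Fintype.card α) : ℝ) : EReal) := by
  refine limsup_le_of_le (h := ?_)
  filter_upwards [eventually_gt_atTop 0] with n hn
  rcases Nat.eq_zero_or_pos {w ∈ S | w.length = n}.ncard with h0 | hpos
  · rw [h0, mul_log2_zero hn]; exact bot_le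
  · rw [mul_log2_of_pos n hpos, EReal.coe_le_coe_iff, div_le_iff₀ (by exact_mod_cast hn),
      mul_comm, ← Real.logb_pow]
    refine Real.logb_le_logb_of_le one_lt_two (by exact_mod_cast hpos) ?_
    have h1 : {w : List α | w.length = n}.ncard = Fintype.card α ^ n := by
      have : Nat.card (List.Vector α n) = Fintype.card α ^ n := by
        rw [Nat.card_eq_fintype_card, card_vector]
      rw [← this]; rfl
    rw [← Nat.cast_pow, ← h1]
    have h2 : {w ∈ S | w.length = n}.ncard ≤ {w : List α | w.length = n}.ncard :=
      Set.ncard_le_ncard (fun w hw => hw.2) (List.finite_length_eq α n)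
    exact_mod_cast h2

/-- The capacity lies between `0` and the logarithm of the alphabet size, so later estimates can be
made in `ℝ`. -/
theorem exists_capacity_eq_coe [Fintype α] {S : Set (List α)} (h : 0 ≤ capacity S) :
    ∃ c : ℝ, 0 ≤ c ∧ capacity S = c := by
  have h1 := capacity_le_card S
  lift capacity S to ℝ using ⟨(h1.trans_lt (EReal.coe_lt_top _)).ne,
    ((EReal.bot_lt_coe 0).trans_le h).ne'⟩ with c
  exact ⟨c, by exact_mod_cast h, rfl⟩

/-- Concatenations of `j` words from `T`. -/
def concat (T : Set (List α)) (j : ℕ) : Set (List α) :=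
  {w | ∃ ws : List (List α), ws.length = j ∧ (∀ v ∈ ws, v ∈ T) ∧ ws.flatten = w}

/-- Concatenations of arbitrarily many words from `T`. -/
def concatStar (T : Set (List α)) : Set (List α) :=
  {w | ∃ ws : List (List α), (∀ v ∈ ws, v ∈ T) ∧ ws.flatten = w}

theorem concat_succ (T : Set (List α)) (j : ℕ) :
    concat T (j + 1) = (fun p : List α × List α => p.1 ++ p.2) '' (T ×ˢ concat T j) := by
  ext w
  constructor
  · rintro ⟨ws, hl, hT, rfl⟩
    match ws, hl with
    | v :: ws, hl =>
      exact ⟨(v, ws.flatten), ⟨hT v (by simp), ws, by simpa using hl,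
        fun x hx => hT x (by simp [hx]), rfl⟩, rfl⟩
  · rintro ⟨⟨v, w⟩, ⟨hv, ws, hl, hT, hw⟩, rfl⟩
    refine ⟨v :: ws, by simp [hl], fun x hx => ?_, by simp [hw]⟩
    rcases List.mem_cons.1 hx with rfl | hx
    · exact hv
    · exact hT x hx

/-- Equal block lengths make the parsing of a concatenation unique. -/
theorem ncard_concat {T : Set (List α)} {q : ℕ} (hT : ∀ w ∈ T, w.length = q) (j : ℕ) :
    (concat T j).ncard = T.ncard ^ j := by
  induction j with
  | zero =>
    have : concat T 0 = {[]} := by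
      ext w
      constructor
      · rintro ⟨ws, hl, -, rfl⟩
        rw [List.length_eq_zero_iff.1 hl]; rfl
      · rintro rfl
        exact ⟨[], rfl, by simp, rfl⟩
    simp [this]
  | succ j ih =>
    rw [concat_succ, Set.InjOn.ncard_image, Set.ncard_prod, ih, pow_succ, mul_comm]
    rintro ⟨v, w⟩ ⟨hv, _⟩ ⟨v', w'⟩ ⟨hv', _⟩ h
    obtain ⟨h1, h2⟩ := List.append_inj h ((hT v hv).trans (hT v' hv').symm)
    exact Prod.ext h1 h2

theorem ofLength_concatStar {T : Set (List α)} {q : ℕ} (hq : 0 < q) (hT : ∀ w ∈ T, w.length = q)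
    (j : ℕ) : {w ∈ concatStar T | w.length = j * q} = concat T j := by
  ext w
  constructor
  · rintro ⟨⟨ws, hws, rfl⟩, hl⟩
    refine ⟨ws, ?_, hws, rfl⟩
    rw [length_flatten_of_forall fun w hw => hT w (hws w hw)] at hl
    exact Nat.eq_of_mul_eq_mul_right hq hl
  · rintro ⟨ws, hl, hws, rfl⟩
    refine ⟨⟨ws, hws, rfl⟩, ?_⟩
    rw [length_flatten_of_forall fun w hw => hT w (hws w hw), hl]

theorem ofLength_concatStar_of_not_dvd {T : Set (List α)} {q n : ℕ}
    (hT : ∀ w ∈ T, w.length = q) (h : ¬ q ∣ n) : {w ∈ concatStar T | w.length = n} = ∅ := by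
  refine Set.eq_empty_of_forall_notMem ?_
  rintro w ⟨⟨ws, hws, rfl⟩, hl⟩
  rw [length_flatten_of_forall fun w hw => hT w (hws w hw)] at hl
  exact h (hl ▸ Dvd.intro_left _ rfl)

/-- The normalised logarithm is constant along positive multiples of `q` and `-∞` at all other
positive lengths. -/
theorem capacity_concatStar {T : Set (List α)} {q : ℕ} (hq : 0 < q)
    (hT : ∀ w ∈ T, w.length = q) (hpos : 0 < T.ncard) :
    capacity (concatStar T) = ((Real.logb 2 T.ncard / q : ℝ) : EReal) := by
  have hq' : (0 : ℝ) < q := by exact_mod_cast hq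
  have hval : ∀ j : ℕ, 0 < j → ((1 / ((j * q : ℕ) : ℝ) : ℝ) : EReal) *
      log2 {w ∈ concatStar T | w.length = j * q}.ncard =
        ((Real.logb 2 T.ncard / q : ℝ) : EReal) := fun j hj => by
    have hj' : (j : ℝ) ≠ 0 := by exact_mod_cast hj.ne'
    rw [ofLength_concatStar hq hT, ncard_concat hT, mul_log2_of_pos _ (pow_pos hpos j),
      Nat.cast_pow, Real.logb_pow]
    congr 1
    push_cast
    field_simp
  refine le_antisymm (limsup_le_of_le (h := ?_)) (le_limsup_of_frequently_le ?_)
  · filter_upwards [eventually_gt_atTop 0] with n hn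
    by_cases hd : q ∣ n
    · obtain ⟨j, rfl⟩ := hd
      rw [mul_comm q j]
      exact (hval j (Nat.pos_of_mul_pos_left hn)).le
    · rw [ofLength_concatStar_of_not_dvd hT hd, Set.ncard_empty, mul_log2_zero hn]
      exact bot_le
  · refine frequently_atTop.2 fun N => ⟨(N + 1) * q, ?_, (hval (N + 1) N.succ_pos).ge⟩
    nlinarith

/-- The single-state graph with one loop for each word of `T`, labeled by that word. -/
def loopGraph {q : ℕ} (T : Set (List α)) (hfin : T.Finite) (hT : ∀ w ∈ T, w.length = q) :
    LabeledGraph α q where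
  V := PUnit
  E := T
  finite_V := inferInstance
  finite_E := hfin.to_subtype
  src := fun _ => PUnit.unit
  tgt := fun _ => PUnit.unit
  label := fun e => e.1
  length_label := fun e => hT e.1 e.2

theorem language_loopGraph {q : ℕ} (hq : 0 < q) {T : Set (List α)} (hfin : T.Finite)
    (hT : ∀ w ∈ T, w.length = q) : (loopGraph T hfin hT).language = concatStar T \ {[]} := by
  ext w
  constructor
  · rintro ⟨γ, ⟨hne, -⟩, rfl⟩
    have hmem : ∀ v ∈ List.map (loopGraph T hfin hT).label γ, v ∈ T := fun v hv => by
      obtain ⟨e, -, rfl⟩ := List.mem_map.1 hv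
      exact e.2
    refine ⟨⟨List.map (loopGraph T hfin hT).label γ, hmem, ?_⟩, fun h => ?_⟩
    · rw [LabeledGraph.pathLabel, List.flatMap_def]
    · have h1 := length_flatten_of_forall fun v hv => hT v (hmem v hv)
      rw [← List.flatMap_def] at h1
      have h2 : (List.flatMap (loopGraph T hfin hT).label γ).length = 0 := by
        rw [List.length_eq_zero_iff]; exact h
      rw [h2, List.length_map] at h1
      have := List.length_pos_iff.2 hne
      have := Nat.mul_pos this hq
      omega
  · rintro ⟨⟨ws, hws, rfl⟩, hne⟩
    obtain ⟨γ, rfl⟩ : ∃ γ : List (loopGraph T hfin hT).E,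
        γ.map (loopGraph T hfin hT).label = ws :=
      ⟨ws.attachWith (· ∈ T) hws, List.attachWith_map_subtype_val hws⟩
    refine ⟨γ, ⟨fun h => hne ?_, ?_⟩, ?_⟩
    · rw [h]; rfl
    · exact (List.pairwise_of_forall fun _ _ => rfl).isChain
    · rw [LabeledGraph.pathLabel, List.flatMap_def]

theorem capacity_diff_nil [Finite α] (S : Set (List α)) : capacity (S \ {[]}) = capacity S := by
  refine capacity_congr_of_eventually ?_
  filter_upwards [eventually_gt_atTop 0] with n hn w hw
  refine ⟨fun h => h.1, fun h => ⟨h, ?_⟩⟩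
  rintro rfl
  simp at hw; omega

/-- Loops carry distinct labels, so anticipation `0` suffices. -/
theorem isEncoderFor_loopGraph [Finite α] {p q : ℕ} (hq : 0 < q) {T : Set (List α)}
    (hfin : T.Finite) (hT : ∀ w ∈ T, w.length = q) (hcard : T.ncard = 2 ^ p) {L : Set (List α)}
    (hL : concatStar T \ {[]} ⊆ L) : (loopGraph T hfin hT).IsEncoderFor p L := by
  refine ⟨fun v => ?_, ⟨0, ?_⟩, ?_, ?_⟩
  · have : {e : (loopGraph T hfin hT).E | (loopGraph T hfin hT).src e = v} = Set.univ :=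
      Set.eq_univ_of_forall fun _ => rfl
    rw [this, Set.ncard_univ, ← hcard]
    rfl
  · intro e e' γ γ' hγ hγ' _ _ _ hlabel
    obtain rfl := List.length_eq_zero_iff.1 hγ
    obtain rfl := List.length_eq_zero_iff.1 hγ'
    simp only [LabeledGraph.pathLabel, List.flatMap_cons, List.flatMap_nil, List.append_nil]
      at hlabel
    exact Subtype.ext hlabel
  · rwa [language_loopGraph hq]
  · rw [language_loopGraph hq, capacity_diff_nil,
      capacity_concatStar hq hT (by rw [hcard]; positivity), hcard]
    congr 2
    push_cast
    rw [Real.logb_pow, Real.logb_self_eq_one one_lt_two, mul_one]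

end Capacity

/-! ### The block code, the encoder and the shrunken systems -/

section Main

variable {α : Type u} [Fintype α] {r : ℕ}

/-- Words `u x u` with `x` approximating `η₀` are admissible, so admissible words occur at
arbitrarily large lengths and the capacity is not `-∞`. -/
theorem capacity_admissible_nonneg {Γ : Set ((Fin (r + 1) → α) → ℝ)}
    {η₀ : (Fin (r + 1) → α) → ℝ} (hη₀ : η₀ ∈ ProbSI α r) {t : ℝ} (ht : 0 < t)
    (hball : ∀ y ∈ ProbSI α r, dist y η₀ ≤ t → y ∈ Γ) : 0 ≤ capacity (admissible Γ) := by
  have := nonempty_of_mem_ProbSI hη₀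
  set u := List.replicate r (Classical.arbitrary α)
  have hu : u.length = r := by simp [u]
  refine capacity_nonneg_of_frequently (frequently_atTop.2 fun N => ?_)
  obtain ⟨n, ⟨x, hx, hxb⟩, h2, hn⟩ := ((ProbSI_subset_realizable hη₀ (t / 2) (half_pos ht)).and
    ((eventually_const_le_mul (5 * r) (half_pos ht)).and (eventually_ge_atTop (N + r + 1)))).exists
  have hlen : (u ++ x ++ u).length = n + 2 * r := by
    simp only [List.length_append, hu, hx]; omega
  have hpre : u <+: u ++ x ++ u := by rw [List.append_assoc]; exact List.prefix_append _ _
  have hSI := fr_mem_ProbSI hu (by rw [hlen]; omega) hpre (List.suffix_append (u ++ x) u)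
  have hn0 : (0 : ℝ) < n := by exact_mod_cast (by omega : 0 < n)
  refine ⟨n + 2 * r, by omega, u ++ x ++ u, ⟨by rw [hlen]; omega,
    hball _ hSI ((dist_pi_le_iff ht.le).2 fun φ => ?_)⟩, hlen⟩
  have e1 := abs_occ_sub_length_mul_fr_le (r := r) (w := u ++ x ++ u) (by rw [hlen]; omega) φ
  have e2 := abs_occ_closure_sub_le hu x φ
  have e3 := hxb φ
  have hr : (0 : ℝ) ≤ r := r.cast_nonneg
  have e4 := mul_le_of_le_one_right hr (le_one_of_mem_Prob hSI.1 φ)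
  have e5 := mul_nonneg hr (hSI.1.1 φ)
  rw [hlen] at e1
  push_cast at e1
  have e6 : |(n : ℝ) * (fr (r + 1) (u ++ x ++ u) φ - η₀ φ)| ≤ n * t := by
    rw [abs_le] at e1 e2 e3 ⊢
    constructor <;> nlinarith
  rw [abs_mul, abs_of_pos hn0] at e6
  rw [Real.dist_eq]
  exact le_of_mul_le_mul_left e6 hn0

/-- A code of `2 ^ p` blocks of length `q`, of rate close to the capacity, whose concatenations
have empirical distributions close to nontrivial combinations of points of `Γ` with `η₀`. -/
theorem exists_block_code {Γ : Set ((Fin (r + 1) → α) → ℝ)} (hΓ : Γ ⊆ Prob α (r + 1))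
    (hclosed : IsClosed Γ) (hconvex : Convex ℝ Γ) {c : ℝ} (hc0 : 0 ≤ c)
    (hc : capacity (admissible Γ) = c) {η₀ : (Fin (r + 1) → α) → ℝ} (hη₀ : η₀ ∈ ProbSI α r)
    {t : ℝ} (ht : 0 < t) {u : List α} (hu : u.length = r) {δ : ℝ} (hδ : 0 < δ) :
    ∃ (lam τ : ℝ) (p q : ℕ) (T : Set (List α)), 0 < lam ∧ 0 < τ ∧ r < q ∧ T.ncard = 2 ^ p ∧
      q * (c - δ) < p ∧ (∀ b ∈ T, b.length = q ∧ u <+: b ∧ u <:+ b) ∧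
      ∀ ws : List (List α), ws ≠ [] → (∀ v ∈ ws, v ∈ T) → ∀ y : List α,
        2 * y.length ≤ τ * ws.length → ∃ s ∈ Γ ∩ ProbSI α r, ∃ a : ℝ, 0 ≤ a ∧ lam ≤ 1 - a ∧
          ∀ φ, |fr (r + 1) (ws.flatten ++ y) φ - (a * s φ + (1 - a) * η₀ φ)| ≤
            lam * t / 2 := by
  -- The filler has length about `n / J`, which costs at most `δ / 4` of rate; its share of `w x` is
  -- at least `1 / (J + 1)`, the value of `lam`. The choice of `κ` below makes `3 κ = lam t / 2`.
  obtain ⟨J, hJ⟩ := exists_nat_gt (4 * c / δ)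
  have hJ' : (0 : ℝ) < J := lt_of_le_of_lt (by positivity) hJ
  have hJ0 : 0 < J := by exact_mod_cast hJ'
  rw [div_lt_iff₀ hδ] at hJ
  set lam : ℝ := 1 / (J + 1) with hlam
  have hlam0 : 0 < lam := by positivity
  set κ : ℝ := lam * t / 6 with hκdef
  have hκ : 0 < κ := by positivity
  -- A limsup only gives good lengths infinitely often; a single good `n` is enough.
  have hfreq : ∃ᶠ n : ℕ in atTop, ((c - δ / 4 : ℝ) : EReal) <
      ((1 / (n : ℝ) : ℝ) : EReal) * log2 {w ∈ admissible Γ | w.length = n}.ncard := by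
    refine frequently_lt_of_lt_limsup (by isBoundedDefault) ?_
    change _ < capacity (admissible Γ)
    rw [hc]
    exact_mod_cast (by linarith : c - δ / 4 < c)
  obtain ⟨n, hcap, ⟨T, hTcard, hT⟩, h5, h6, hnr⟩ := (hfreq.and_eventually
    ((eventually_exists_blocks hclosed hη₀ hu hJ0 hκ).and
    ((eventually_const_le_mul (5 * r) hκ).and
    ((eventually_const_le_mul ((2 + 2 * r) * c + 2) (ε := δ / 2) (by positivity)).and
      (eventually_gt_atTop r))))).exists
  have hn : 0 < n := by omega
  have hn' : (0 : ℝ) < n := by exact_mod_cast hn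
  have hN : 0 < (admissibleOfLength n Γ).ncard := by
    by_contra h0
    have h0' : {w ∈ admissible Γ | w.length = n}.ncard = 0 :=
      Nat.eq_zero_of_not_pos h0
    rw [h0', mul_log2_zero hn] at hcap
    exact not_lt_bot hcap
  have hrate : (c - δ / 4) * n < Real.logb 2 (admissibleOfLength n Γ).ncard := by
    change _ < _ * log2 (admissibleOfLength n Γ).ncard at hcap
    rw [mul_log2_of_pos n hN, EReal.coe_lt_coe_iff, lt_div_iff₀ hn'] at hcap
    exact hcap
  set N := (admissibleOfLength n Γ).ncard
  set p := Nat.log 2 N with hp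
  have hpN : 2 ^ p ≤ N := Nat.pow_log_le_self 2 hN.ne'
  have hp1 : Real.logb 2 N < p + 1 := by
    rw [Real.logb_lt_iff_lt_rpow one_lt_two (by exact_mod_cast hN)]
    have h : N < 2 ^ (p + 1) := Nat.lt_pow_succ_log_self one_lt_two N
    exact_mod_cast h
  obtain ⟨T', hT'T, hT'⟩ := Set.exists_subset_card_eq (hpN.trans hTcard.ge)
  refine ⟨lam, κ * n, p, n + (n / J + 1) + 2 * r, T', hlam0, by positivity,
    hnr.trans_le (Nat.le_add_right_of_le (Nat.le_add_right _ _)), hT', ?_,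
    fun b hb => ?_, fun ws hws hmem y hy => ?_⟩
  -- Rate loss: `δ / 4` from the limsup, `δ / 4` from the filler, and `δ / 2` for the bounded terms,
  -- including the rounding of `log₂ N` to `p`.
  · have h1 : ((n / J : ℕ) : ℝ) ≤ n / J := Nat.cast_div_le
    have h2 : ((n / J : ℕ) : ℝ) * c ≤ n / J * c := mul_le_mul_of_nonneg_right h1 hc0
    have h3 : (n : ℝ) / J * c ≤ n * (δ / 4) := by
      rw [div_mul_eq_mul_div, div_le_iff₀ hJ']
      nlinarith
    have h4 : (0 : ℝ) ≤ ((n / J : ℕ) : ℝ) := Nat.cast_nonneg _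
    have hr : (0 : ℝ) ≤ r := r.cast_nonneg
    push_cast
    nlinarith
  · obtain ⟨h1, h2, h3, -⟩ := hT b (hT'T hb)
    exact ⟨h1, h2, h3⟩
  · obtain ⟨s, hs, hb⟩ := fr_flatten_append_near (hconvex.inter convex_ProbSI)
      (fun x hx => hΓ hx.1) hn h5 hη₀.1 hws (fun w hw => by
        obtain ⟨h1, -, -, h4⟩ := hT w (hT'T (hmem w hw))
        exact ⟨h1, h4⟩) hy
    refine ⟨s, hs, _, by positivity, ?_, fun φ => (hb φ).trans ?_⟩
    · have h1 : n < J * (n / J + 1) := Nat.lt_mul_div_succ n hJ0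
      have h2 : (n : ℝ) < J * ((n / J + 1 : ℕ) : ℝ) := by exact_mod_cast h1
      generalize ((n / J + 1 : ℕ) : ℝ) = n' at h2
      have h3 : 0 < n' := by
        by_contra h; nlinarith
      rw [hlam, one_sub_div (by positivity), div_le_div_iff₀ (by positivity) (by positivity)]
      linarith
    · rw [hκdef]; linarith

theorem mem_of_mem_shrink {k : ℕ} {Γ : Set ((Fin k → α) → ℝ)} {ε : ℝ} {η : (Fin k → α) → ℝ}
    (h : η ∈ shrink Γ ε) : ∀ y ∈ Prob α k, dist y η ≤ ε → y ∈ Γ := by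
  intro y hy hd
  by_contra hyΓ
  have h1 := h.2.trans_le (Metric.infEDist_le_edist_of_mem (⟨hy, hyΓ⟩ : y ∈ Prob α k \ Γ))
  rw [edist_dist, dist_comm] at h1
  exact absurd (ENNReal.ofReal_le_ofReal hd) h1.not_ge

theorem mem_shrink_of_forall {k : ℕ} {Γ : Set ((Fin k → α) → ℝ)} {ε t : ℝ} (hεt : ε < t)
    (ht : 0 < t) {η : (Fin k → α) → ℝ} (hη : η ∈ Prob α k)
    (h : ∀ y ∈ Prob α k, dist y η ≤ t → y ∈ Γ) : η ∈ shrink Γ ε := by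
  refine ⟨hη, ((ENNReal.ofReal_lt_ofReal_iff ht).2 hεt).trans_le
    (Metric.le_infEDist.2 fun y hy => ?_)⟩
  rw [edist_dist]
  refine ENNReal.ofReal_le_ofReal ?_
  by_contra hlt
  exact hy.2 (h y hy.1 (by rw [dist_comm]; linarith))

/-- Shrunken systems are relatively open, hence fat. -/
theorem isFat_shrink (Γ : Set ((Fin (r + 1) → α) → ℝ)) (ε : ℝ) : IsFat (shrink Γ ε) := by
  have h : ((↑) ⁻¹' shrink Γ ε : Set (ProbSI α r)) =
      (↑) ⁻¹' {η | ENNReal.ofReal ε < Metric.infEDist η (Prob α (r + 1) \ Γ)} := by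
    ext η
    exact ⟨fun h => h.2, fun h => ⟨η.2.1, h⟩⟩
  have hopen : IsOpen ((↑) ⁻¹' shrink Γ ε : Set (ProbSI α r)) := by
    rw [h]
    exact (isOpen_lt continuous_const Metric.continuous_infEDist).preimage continuous_subtype_val
  rw [IsFat, hopen.interior_eq]

theorem exists_interior_ball {Γ : Set ((Fin (r + 1) → α) → ℝ)} (hfat : IsFat Γ)
    (hne : (Γ ∩ ProbSI α r).Nonempty) :
    ∃ η ∈ ProbSI α r, ∃ ρ : ℝ, 0 < ρ ∧ ∀ y ∈ ProbSI α r, dist y η < ρ → y ∈ Γ := by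
  obtain ⟨x, hxΓ, hx⟩ := hne
  have h1 : (interior ((↑) ⁻¹' Γ : Set (ProbSI α r))).Nonempty := by
    rw [← closure_nonempty_iff, hfat]
    exact ⟨⟨x, hx⟩, subset_closure hxΓ⟩
  obtain ⟨η, hη⟩ := h1
  obtain ⟨ρ, hρ, hball⟩ := Metric.mem_nhds_iff.1 (mem_interior_iff_mem_nhds.1 hη)
  exact ⟨η, η.2, ρ, hρ, fun y hy hd => hball (show (⟨y, hy⟩ : ProbSI α r) ∈ Metric.ball η ρ from hd)⟩

/-- Concatenations of code blocks begin and end with `u`, so their distributions are shift-invariant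
and a ball relative to the shift-invariant measures suffices. -/
theorem exists_block_encoder {Γ : Set ((Fin (r + 1) → α) → ℝ)} (hΓ : Γ ⊆ Prob α (r + 1))
    (hclosed : IsClosed Γ) (hconvex : Convex ℝ Γ) {c : ℝ} (hc0 : 0 ≤ c)
    (hc : capacity (admissible Γ) = c) {η₀ : (Fin (r + 1) → α) → ℝ} (hη₀ : η₀ ∈ ProbSI α r)
    {t : ℝ} (ht : 0 < t) (hpos : ∀ φ, t ≤ η₀ φ)
    (hball : ∀ y ∈ ProbSI α r, dist y η₀ ≤ t → y ∈ Γ) {δ : ℝ} (hδ : 0 < δ) :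
    ∃ (p q : ℕ) (G : LabeledGraph α q), 0 < q ∧ G.IsBlock ∧
      G.IsEncoderFor p (admissible Γ) ∧ c - δ < (p : ℝ) / q := by
  have := nonempty_of_mem_ProbSI hη₀
  have hu : (List.replicate r (Classical.arbitrary α)).length = r := by simp
  set u := List.replicate r (Classical.arbitrary α)
  obtain ⟨lam, τ, p, q, T, hlam, hτ, hrq, hTcard, hpq, hT, hnear⟩ :=
    exists_block_code hΓ hclosed hconvex hc0 hc hη₀ ht hu hδ
  have hq : 0 < q := by omega
  have hTfin : T.Finite := Set.finite_of_ncard_pos (by rw [hTcard]; positivity)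
  refine ⟨p, q, loopGraph T hTfin fun b hb => (hT b hb).1, hq,
    show Nat.card PUnit = 1 from Nat.card_unique,
    isEncoderFor_loopGraph hq hTfin (fun b hb => (hT b hb).1) hTcard ?_, ?_⟩
  · rintro w ⟨⟨ws, hws, rfl⟩, hne⟩
    have hws0 : ws ≠ [] := by
      rintro rfl
      exact hne rfl
    have hlen := length_flatten_of_forall fun v hv => (hT v (hws v hv)).1
    have hlen' : r < ws.flatten.length := by
      rw [hlen]
      have := List.length_pos_iff.2 hws0
      nlinarith
    have hSI : fr (r + 1) ws.flatten ∈ ProbSI α r := by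
      refine fr_mem_ProbSI hu hlen' ?_ ?_
      · obtain ⟨v, vs, rfl⟩ := List.exists_cons_of_ne_nil hws0
        exact (hT v (hws v (by simp))).2.1.trans (by simp)
      · obtain ⟨vs, v, rfl⟩ := List.eq_nil_or_concat' ws |>.resolve_left hws0
        exact (hT v (hws v (by simp))).2.2.trans (by simp)
    obtain ⟨s, hs, a, ha0, ha, hb⟩ := hnear ws hws0 hws [] (by simp; positivity)
    rw [List.append_nil] at hb
    refine ⟨hlen', mem_of_near_combination (Q := ProbSI α r) hconvex
      (fun z hz s hs a ha h => extrapolate_mem_ProbSI hz hs ha h) ht.le hpos hball hs.1 hs.2 hSI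
      ha0 (by linarith) fun φ => (hb φ).trans ?_⟩
    nlinarith [mul_le_mul_of_nonneg_right ha ht.le, mul_pos hlam ht]
  · rw [lt_div_iff₀ (by exact_mod_cast hq)]
    linarith

theorem language_blockGraph {k m : ℕ} (hm : 0 < m) (Γ : Set ((Fin k → α) → ℝ)) :
    (blockGraph m Γ).language = blockLanguage m Γ \ {[]} :=
  language_loopGraph hm (finite_admissibleOfLength m Γ) fun _ hw => hw.2

theorem blockLanguage_shrink_subset {Γ : Set ((Fin (r + 1) → α) → ℝ)} (hconvex : Convex ℝ Γ)
    {ε : ℝ} {m : ℕ} (hm : r < m) (hε : (r : ℝ) ≤ ε * m) :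
    blockLanguage m (shrink Γ ε) \ {[]} ⊆ admissible Γ := by
  rintro w ⟨⟨ws, hws, rfl⟩, hne⟩
  have hws0 : ws ≠ [] := by
    rintro rfl
    exact hne rfl
  refine ⟨?_, fr_flatten_mem hconvex hm hε hws0 fun w hw =>
    ⟨(hws w hw).2, mem_of_mem_shrink (hws w hw).1.2⟩⟩
  rw [length_flatten_of_forall fun v hv => (hws v hv).2]
  have := List.length_pos_iff.2 hws0
  nlinarith

/-- All large block lengths are good for all sufficiently small shrinkings. -/
theorem eventually_card_admissible_shrink {Γ : Set ((Fin (r + 1) → α) → ℝ)}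
    (hΓ : Γ ⊆ Prob α (r + 1)) (hclosed : IsClosed Γ) (hconvex : Convex ℝ Γ) {c : ℝ} (hc0 : 0 ≤ c)
    (hc : capacity (admissible Γ) = c) {η₀ : (Fin (r + 1) → α) → ℝ} (hη₀ : η₀ ∈ ProbSI α r)
    {t : ℝ} (ht : 0 < t) (hpos : ∀ φ, t ≤ η₀ φ)
    (hball : ∀ y ∈ Prob α (r + 1), dist y η₀ ≤ t → y ∈ Γ) {δ : ℝ} (hδ : 0 < δ) :
    ∃ ε₀ : ℝ, 0 < ε₀ ∧ ∀ ε ≤ ε₀, ∀ᶠ m : ℕ in atTop,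
      0 < (admissibleOfLength m (shrink Γ ε)).ncard ∧
      c - δ < Real.logb 2 (admissibleOfLength m (shrink Γ ε)).ncard / m := by
  have := nonempty_of_mem_ProbSI hη₀
  have hu : (List.replicate r (Classical.arbitrary α)).length = r := by simp
  set u := List.replicate r (Classical.arbitrary α)
  obtain ⟨lam, τ, p, q, T, hlam, hτ, hrq, hTcard, hpq, hT, hnear⟩ :=
    exists_block_code hΓ hclosed hconvex hc0 hc hη₀ ht hu (half_pos hδ)
  have hq : 0 < q := by omega
  have hq' : (0 : ℝ) < q := by exact_mod_cast hq
  -- The code error and the radius of the ball to be kept inside `Γ` are `lam t / 2` each; they sum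
  -- to `lam t ≤ (1 - a) t`, and the radius exceeds `ε`.
  refine ⟨lam * t / 4, by positivity, fun ε hε => ?_⟩
  filter_upwards [(Nat.tendsto_div_const_atTop hq.ne').eventually
      (eventually_const_le_mul (2 * q) hτ), eventually_ge_atTop q,
    eventually_const_le_mul (p + 1) (half_pos hδ)] with m h1 hmq h3
  have hj : 0 < m / q := Nat.div_pos hmq hq
  have hdm : q * (m / q) + m % q = m := Nat.div_add_mod m q
  have hmod : m % q < q := Nat.mod_lt _ hq
  generalize m / q = j at h1 hj hdm
  generalize m % q = ρ at hdm hmod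
  set y := List.replicate ρ (Classical.arbitrary α)
  have hy : y.length = ρ := by simp [y]
  have hTlen : ∀ b ∈ T, b.length = q := fun b hb => (hT b hb).1
  -- One fixed code serves every large `m`: `j = m / q` blocks, then a fixed padding of `m % q`
  -- letters.
  have hsub : (· ++ y) '' concat T j ⊆ admissibleOfLength m (shrink Γ ε) := by
    rintro _ ⟨_, ⟨ws, hl, hws, rfl⟩, rfl⟩
    have hlen := length_flatten_of_forall fun v hv => hTlen v (hws v hv)
    have hlen' : (ws.flatten ++ y).length = m := by
      rw [List.length_append, hlen, hl, hy, ← hdm, mul_comm]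
    have hws0 : ws ≠ [] := by
      rintro rfl
      simp at hl; omega
    have hfr := fr_mem_Prob (r := r) (w := ws.flatten ++ y) (by rw [hlen']; omega)
    refine ⟨⟨by rw [hlen']; omega, ?_⟩, hlen'⟩
    obtain ⟨s, hs, a, ha0, ha, hb⟩ := hnear ws hws0 hws y (by
      rw [hy, hl]
      have : (ρ : ℝ) ≤ q := by exact_mod_cast hmod.le
      linarith)
    refine mem_shrink_of_forall (t := lam * t / 2) (by nlinarith [mul_pos hlam ht])
      (by positivity) hfr fun z hz hd => ?_
    refine mem_of_near_combination (Q := Prob α (r + 1)) hconvex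
      (fun z hz s hs a ha h => extrapolate_mem_Prob hz hs ha h) ht.le hpos hball hs.1 hs.2.1 hz
      ha0 (by linarith) fun φ => ?_
    have e1 := hb φ
    have e2 := (dist_le_pi_dist _ _ φ).trans hd
    have e3 := mul_le_mul_of_nonneg_right ha ht.le
    rw [Real.dist_eq] at e2
    rw [abs_le] at e1 e2 ⊢
    constructor <;> linarith
  have hcard : 2 ^ (p * j) ≤ (admissibleOfLength m (shrink Γ ε)).ncard := by
    have h := Set.ncard_le_ncard hsub (finite_admissibleOfLength m _)
    rwa [Set.ncard_image_of_injective _ (List.append_left_injective y), ncard_concat hTlen,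
      hTcard, ← pow_mul] at h
  have hN : 0 < (admissibleOfLength m (shrink Γ ε)).ncard := lt_of_lt_of_le (by positivity) hcard
  refine ⟨hN, ?_⟩
  have hm0 : (0 : ℝ) < m := by exact_mod_cast (by omega : 0 < m)
  rw [lt_div_iff₀ hm0]
  have hlog : (p : ℝ) * j ≤ Real.logb 2 (admissibleOfLength m (shrink Γ ε)).ncard := by
    rw [Real.le_logb_iff_rpow_le one_lt_two (by exact_mod_cast hN)]
    exact_mod_cast hcard
  have hm : (m : ℝ) = q * j + ρ := by exact_mod_cast hdm.symm
  have hρ : (ρ : ℝ) ≤ q := by exact_mod_cast hmod.le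
  have hmj : (m : ℝ) ≤ q * (j + 1) := by rw [hm]; linarith
  -- Truncating `m / q` to `j` loses at most `p` bits, absorbed by the second `δ / 2`.
  have e1 : (m : ℝ) * p ≤ q * ((j + 1) * p) := by
    have := mul_le_mul_of_nonneg_right hmj (Nat.cast_nonneg p : (0 : ℝ) ≤ p)
    linarith
  have e2 : q * (m * (c - δ / 2)) < q * ((j + 1) * p) := by
    have := mul_lt_mul_of_pos_left hpq hm0
    linarith
  have e3 := lt_of_mul_lt_mul_left e2 hq'.le
  linarith

end Main

end SCS

theorem mainTheorem9 {α : Type u} [Fintype α] (r : ℕ) (Γ : Set ((Fin (r + 1) → α) → ℝ))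
    (hΓ : Γ ⊆ SCS.Prob α (r + 1)) (hclosed : IsClosed Γ) (hconvex : Convex ℝ Γ)
    (hfat : SCS.IsFat Γ) (hne : (Γ ∩ SCS.ProbSI α r).Nonempty) :
    -- block encoders with rate `p / q` arbitrarily close to the capacity
    (∀ δ : ℝ, 0 < δ → ∃ (p q : ℕ) (G : SCS.LabeledGraph α q),
      0 < q ∧ G.IsBlock ∧ G.IsEncoderFor p (SCS.admissible Γ) ∧
      SCS.capacity (SCS.admissible Γ) - (δ : EReal) < (((p : ℝ) / (q : ℝ) : ℝ) : EReal) ∧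
      (((p : ℝ) / (q : ℝ) : ℝ) : EReal) ≤ SCS.capacity (SCS.admissible Γ)) ∧
    -- the block construction on the shrunken systems
    ((∃ ε : ℝ, SCS.IsAdmissibleEps Γ ε) →
      ∀ δ : ℝ, 0 < δ → ∃ ε₀ : ℝ, 0 < ε₀ ∧ ∀ ε : ℝ, 0 < ε → ε ≤ ε₀ →
        SCS.IsAdmissibleEps Γ ε ∧ ∃ M : ℕ, ∀ m : ℕ, M < m →
          (SCS.blockGraph m (SCS.shrink Γ ε)).language =
            SCS.blockLanguage m (SCS.shrink Γ ε) \ {[]} ∧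
          (SCS.blockGraph m (SCS.shrink Γ ε)).language ⊆ SCS.admissible Γ ∧
          SCS.capacity (SCS.admissible Γ) - (δ : EReal) <
            SCS.capacity (SCS.blockLanguage m (SCS.shrink Γ ε)) ∧
          SCS.capacity (SCS.blockLanguage m (SCS.shrink Γ ε)) ≤
            SCS.capacity (SCS.admissible Γ)) := by
  obtain ⟨η, hη, ρ, hρ, hball⟩ := SCS.exists_interior_ball hfat hne
  obtain ⟨η₀, hη₀, t, ht, hpos, hball₀⟩ := SCS.exists_positive_center hη hρ hball
  obtain ⟨c, hc0, hc⟩ :=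
    SCS.exists_capacity_eq_coe (SCS.capacity_admissible_nonneg hη₀ ht hball₀)
  refine ⟨fun δ hδ => ?_, ?_⟩
  · obtain ⟨p, q, G, hq, hblock, henc, hrate⟩ :=
      SCS.exists_block_encoder hΓ hclosed hconvex hc0 hc hη₀ ht hpos hball₀ hδ
    refine ⟨p, q, G, hq, hblock, henc, ?_, ?_⟩
    · rw [hc]
      exact_mod_cast hrate
    · rw [← henc.2.2.2]
      exact SCS.capacity_mono_of_eventually (Eventually.of_forall fun _ w hw _ => henc.2.2.1 hw)
  · rintro ⟨ε₁, hε₁, ⟨η₁, hη₁, hη₁SI⟩, -⟩ δ hδ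
    -- A second centre, with its ball in the full simplex: padded words need not be shift-invariant,
    -- and `Γ_ε` is defined by distances to all probability measures outside `Γ`.
    obtain ⟨η₂, hη₂, t₂, ht₂, hpos₂, hball₂⟩ := SCS.exists_positive_center
      (Q := SCS.Prob α (r + 1)) hη₁SI hε₁
      fun y hy hd => SCS.mem_of_mem_shrink hη₁ y hy hd.le
    obtain ⟨ε₂, hε₂, hcard⟩ := SCS.eventually_card_admissible_shrink hΓ hclosed hconvex hc0 hc
      hη₂ ht₂ hpos₂ hball₂ hδ
    -- For `ε ≤ ε₁` the measure `η₁` remains in `Γ_ε`, since the shrunken systems decrease in `ε`.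
    refine ⟨min ε₁ ε₂, lt_min hε₁ hε₂, fun ε hε hle => ⟨⟨hε, ⟨η₁, ⟨hη₁.1, ?_⟩, hη₁SI⟩,
      SCS.isFat_shrink Γ ε⟩, ?_⟩⟩
    · exact (ENNReal.ofReal_le_ofReal (hle.trans (min_le_left _ _))).trans_lt hη₁.2
    obtain ⟨M, hM⟩ := eventually_atTop.1 ((hcard ε (hle.trans (min_le_right _ _))).and
      ((SCS.eventually_const_le_mul r hε).and (eventually_gt_atTop r)))
    refine ⟨M, fun m hm => ?_⟩
    obtain ⟨⟨hN, hrate⟩, hrm, hm'⟩ := hM m hm.le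
    have hm0 : 0 < m := by omega
    have hlang := SCS.language_blockGraph hm0 (SCS.shrink Γ ε)
    have hsub := SCS.blockLanguage_shrink_subset hconvex hm' hrm
    refine ⟨hlang, hlang ▸ hsub, ?_, ?_⟩
    · have h : SCS.capacity (SCS.blockLanguage m (SCS.shrink Γ ε)) = _ :=
        SCS.capacity_concatStar hm0 (fun _ hw => hw.2) hN
      rw [h, hc]
      exact_mod_cast hrate
    · rw [← SCS.capacity_diff_nil]
      exact SCS.capacity_mono_of_eventually (Eventually.of_forall fun _ w hw _ => hsub hw)
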